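/- A local model $U$ consists of an open set $U_0\subseteq\mathbb R^n$ ($n\ge 0$), with coordinates $x=(x_1,\dots,x_n)$ of degree $0$, together with finitely many formal variables: commuting variables $\zeta_1,\dots,\zeta_p$ of even nonzero degrees and anticommuting variables $\eta_1,\dots,\eta_q$ of odd degrees in $\mathbb Z$ (the $\zeta$'s commute with the $\eta$'s). Let $\mathcal A(U)$ be the algebra of all formal power series $$f=\sum_{I\in\mathbb Z_{\ge0}^p,\ J\subseteq\{1,\dots,q\}} f_{IJ}(x)\,\zeta^I\eta^J,\qquad f_{IJ}\in C^\infty(U_0),$$ let $\mathcal F(U)_k\subseteq\mathcal A(U)$ be the set of those series all of whose monomials have total degree $k$, let $\mathcal F(U)=\bigoplus_{k\in\mathbb Z}\mathcal F(U)_k$ (finite sums of homogeneous series), and let $\mathcal P(U)\subseteq\mathcal A(U)$ be the set of polynomials in $\zeta,\eta$ with coefficients in $C^\infty(U_0)$. A degree-preserving morphism $\varphi:U\to U'$ is given by components $\varphi^*x'_i\in\mathcal F(U)_0$, $\varphi^*\zeta'_a\in\mathcal F(U)_{\deg\zeta'_a}$, $\varphi^*\eta'_b\in\mathcal F(U)_{\deg\eta'_b}$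 such that the map $x_0:U_0\to\mathbb R^{n'}$ obtained from $(\varphi^*x'_i)_i$ by setting all $\zeta,\eta$ to zero takes values in $U'_0$. The pullback of $f\in\mathcal A(U')$ is obtained by substitution and Taylor expansion around $x_0$: $$\varphi^*f=\sum_{\alpha,I,J}\frac1{\alpha!}\,(\partial^\alpha f_{IJ})(x_0)\,(\varphi^*x'-x_0)^\alpha\,(\varphi^*\zeta')^I(\varphi^*\eta')^J\in\mathcal A(U).$$ A class of functions $\mathcal C$ assigns to every local model $U$ a subset $\mathcal C(U)\subseteq\mathcal A(U)$. It is stable under degree-preserving morphisms of the same type if, for every degree-preserving morphism $\varphi:U\to U'$ all of whose components lie in $\mathcal C(U)$, one has $\varphi^*(\mathcal C(U'))\subseteq\mathcal C(U)$. **Theorem.** For every $U$, $\mathcal F(U)$ is a subalgebra of $\mathcal A(U)$. The class $\mathcal F$ contains $\mathcal P$ and is stable under degree-preserving morphisms of the same type, and it is the smallest such class: if a class $\mathcal C$ satisfies $\mathcal P(U)\subseteq\mathcal C(U)$ for all $U$ and is stable under degree-preserving morphisms of the same type, then $\mathcal F(U)\subseteq\mathcal C(U)$ for all $U$. -/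

import Mathlib

open scoped Manifold ContDiff

noncomputable section

/-- A local model `U = U₀ × V`: an open set `U₀ ⊆ ℝⁿ` together with a finite-dimensional
`ℤ`-graded vector space `V` without degree-zero part, given by its linear coordinates. There are
`numEven` coordinates `ζ` of even nonzero degree and `numOdd` coordinates `η` of odd degree. -/
structure GradedDomain where
  dim : ℕ
  base : TopologicalSpace.Opens (EuclideanSpace ℝ (Fin dim))
  numEven : ℕ
  numOdd : ℕ
  evenDeg : Fin numEven → ℤ
  oddDeg : Fin numOdd → ℤ
  even_evenDeg : ∀ a, Even (evenDeg a)
  evenDeg_ne_zero : ∀ a, evenDeg a ≠ 0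
  odd_oddDeg : ∀ b, Odd (oddDeg b)

namespace GradedDomain

/-- The ring `C^∞(U₀)` of smooth real functions of the degree-zero coordinates. -/
abbrev Smooth (U : GradedDomain) : Type :=
  C^∞⟮𝓘(ℝ, EuclideanSpace ℝ (Fin U.dim)), U.base; ℝ⟯

/-- All formal power series in the commuting variables `ζ` and the anticommuting variables `η`
(where each `ζ` commutes with each `η`), with coefficients in `C^∞(U₀)`; no condition on degrees.
The variable `η b` is `ι (e b)` in the exterior algebra of the free module on `numOdd`
generators. -/
abbrev Series (U : GradedDomain) : Type :=
  MvPowerSeries (Fin U.numEven) (ExteriorAlgebra U.Smooth (Fin U.numOdd → U.Smooth))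

/-- The coefficient `f_{I J} ∈ C^∞(U₀)` of `ζ^I η^J` in `f`, where
`η^J = η_{j₁} ⋯ η_{jₛ}` for `J = {j₁ < ⋯ < jₛ}`. -/
def coef (U : GradedDomain) (I : Fin U.numEven →₀ ℕ) (J : Finset (Fin U.numOdd)) :
    U.Series →ₗ[U.Smooth] U.Smooth :=
  (Pi.basisFun U.Smooth (Fin U.numOdd)).ExteriorAlgebra.coord J ∘ₗ
    (MvPowerSeries.coeff I).restrictScalars U.Smooth

/-- The degree of the monomial `ζ^I η^J`. -/
def monomialDeg (U : GradedDomain) (I : Fin U.numEven →₀ ℕ) (J : Finset (Fin U.numOdd)) : ℤ :=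
  ∑ a, (I a : ℤ) * U.evenDeg a + ∑ b ∈ J, U.oddDeg b

/-- `𝓕(U)_k`: formal power series all of whose monomials have degree `k`. -/
def homogeneous (U : GradedDomain) (k : ℤ) : Submodule U.Smooth U.Series where
  carrier := {f | ∀ I J, U.coef I J f ≠ 0 → U.monomialDeg I J = k}
  zero_mem' := fun I J h => absurd (map_zero _) h
  add_mem' := by
    intro f g hf hg I J h
    by_contra hk
    have h1 : U.coef I J f = 0 := by_contra fun h' => hk (hf I J h')
    have h2 : U.coef I J g = 0 := by_contra fun h' => hk (hg I J h')
    exact h (by rw [map_add, h1, h2, add_zero])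
  smul_mem' := by
    intro c f hf I J h
    refine hf I J fun h' => h ?_
    rw [map_smul, h', smul_zero]

/-- `𝓕(U)`: finite sums of homogeneous formal power series. -/
def gradedFunctions (U : GradedDomain) : Submodule U.Smooth U.Series :=
  ⨆ k : ℤ, U.homogeneous k

/-- Polynomials in the variables of nonzero degree with coefficients in `C^∞(U₀)`. -/
def polynomials (U : GradedDomain) : Set U.Series :=
  {f | {IJ : (Fin U.numEven →₀ ℕ) × Finset (Fin U.numOdd) | U.coef IJ.1 IJ.2 f ≠ 0}.Finite}

/-- The restriction of `f` to the base `U₀` (all `ζ` and `η` are set to zero). -/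
def body (U : GradedDomain) (f : U.Series) : U.Smooth := U.coef 0 ∅ f

/-- A smooth function of the degree-zero coordinates, as a (constant) power series. -/
def ofSmooth (U : GradedDomain) (g : U.Smooth) : U.Series := algebraMap U.Smooth U.Series g

/-- The extension by zero of a function on `U₀` to all of `ℝⁿ`. -/
def extend (U : GradedDomain) (g : U.Smooth) : EuclideanSpace ℝ (Fin U.dim) → ℝ :=
  Function.extend Subtype.val g 0

theorem extend_apply (U : GradedDomain) (g : U.Smooth) (y : U.base) : U.extend g y = g y :=
  Subtype.val_injective.extend_apply _ _ _

theorem contDiffAt_extend (U : GradedDomain) (g : U.Smooth) (y : U.base) :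
    ContDiffAt ℝ ∞ (U.extend g) y := by
  rw [← contMDiffAt_iff_contDiffAt, ← contMDiffAt_subtype_iff]
  have h : (fun x : U.base => U.extend g x) = g := funext fun x => U.extend_apply g x
  rw [h]
  exact g.contMDiff y

/-- The partial derivative `∂g/∂xᵢ` on `U₀`. -/
def pderiv (U : GradedDomain) (i : Fin U.dim) (g : U.Smooth) : U.Smooth :=
  ⟨fun y => fderiv ℝ (U.extend g) y (EuclideanSpace.single i 1), by
    intro y
    refine (contMDiffAt_subtype_iff
      (f := fun z => fderiv ℝ (U.extend g) z (EuclideanSpace.single i 1))).2 ?_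
    rw [contMDiffAt_iff_contDiffAt]
    exact ((U.contDiffAt_extend g y).fderiv_right (m := ∞) le_rfl).clm_apply contDiffAt_const⟩

/-- The iterated partial derivative `∂^α g = ∂₁^{α₁} ⋯ ∂ₙ^{αₙ} g`. -/
def iteratedPDeriv (U : GradedDomain) (α : Fin U.dim →₀ ℕ) (g : U.Smooth) : U.Smooth :=
  (List.finRange U.dim).foldr (fun i u => (U.pderiv i)^[α i] u) g

/-- A degree-preserving morphism `U → U'`, given by the images (pullbacks) `x i`, `ζ a`, `η b` of
the coordinates of `U'`, which are formal power series on `U` of the same degrees as the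
coordinates. The underlying map of bases sends `U₀` into `U'₀`. -/
structure Morphism (U U' : GradedDomain) where
  x : Fin U'.dim → U.Series
  ζ : Fin U'.numEven → U.Series
  η : Fin U'.numOdd → U.Series
  x_mem : ∀ i, x i ∈ U.homogeneous 0
  ζ_mem : ∀ a, ζ a ∈ U.homogeneous (U'.evenDeg a)
  η_mem : ∀ b, η b ∈ U.homogeneous (U'.oddDeg b)
  body_mem : ∀ y : U.base, WithLp.toLp 2 (fun i => U.body (x i) y) ∈ U'.base

namespace Morphism

variable {U U' : GradedDomain}

/-- The underlying map of bases `U₀ → U'₀`. -/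
def baseMap (φ : Morphism U U') (y : U.base) : U'.base :=
  ⟨WithLp.toLp 2 (fun i => U.body (φ.x i) y), φ.body_mem y⟩

/-- The composition of a smooth function on `U'₀` with the underlying map `U₀ → U'₀`. -/
def baseComp (φ : Morphism U U') (g : U'.Smooth) : U.Smooth :=
  ⟨fun y => g (φ.baseMap y), by
    have hb : ContMDiff 𝓘(ℝ, EuclideanSpace ℝ (Fin U.dim)) 𝓘(ℝ, EuclideanSpace ℝ (Fin U'.dim)) ∞
        (fun y : U.base => (φ.baseMap y : EuclideanSpace ℝ (Fin U'.dim))) := by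
      have h1 : ContMDiff 𝓘(ℝ, EuclideanSpace ℝ (Fin U.dim)) 𝓘(ℝ, Fin U'.dim → ℝ) ∞
          (fun (y : U.base) (i : Fin U'.dim) => U.body (φ.x i) y) :=
        contMDiff_pi_space.2 fun i => (U.body (φ.x i)).contMDiff
      exact (PiLp.continuousLinearEquiv 2 ℝ
        (fun _ : Fin U'.dim => ℝ)).symm.contDiff.contMDiff.comp h1
    intro y
    have h2 : (fun y : U.base => g (φ.baseMap y)) =
        U'.extend g ∘ fun y : U.base => (φ.baseMap y : EuclideanSpace ℝ (Fin U'.dim)) :=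
      funext fun z => (U'.extend_apply g (φ.baseMap z)).symm
    rw [h2]
    exact ContMDiffAt.comp y (U'.contDiffAt_extend g (φ.baseMap y)).contMDiffAt (hb y)⟩

/-- The contribution of the coefficient `f_{I J}` and of the multi-index `α` to the substitution
of the components of `φ` into `f`:
`(1/α!) · (∂^α f_{I J})(x₀) · (x - x₀)^α · ζ^I · η^J`, where `x₀` is the underlying map of bases,
so that the sum over `α` is the Taylor expansion of `f_{I J}(x)` around `x₀`. -/
def pullbackTerm (φ : Morphism U U') (f : U'.Series) (α : Fin U'.dim →₀ ℕ)
    (I : Fin U'.numEven →₀ ℕ) (J : Finset (Fin U'.numOdd)) : U.Series :=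
  U.ofSmooth ((∏ i, ((α i).factorial : ℝ))⁻¹ • φ.baseComp (U'.iteratedPDeriv α (U'.coef I J f))) *
    (List.ofFn fun i => (φ.x i - U.ofSmooth (U.body (φ.x i))) ^ α i).prod *
    (List.ofFn fun a => φ.ζ a ^ I a).prod *
    (List.ofFn fun b => if b ∈ J then φ.η b else 1).prod

/-- The pullback `φ^* f`: the sum of `pullbackTerm` over all `α`, `I`, `J`, computed coefficient
by coefficient. Only finitely many terms contribute to each coefficient, as `x - x₀`, `ζ` and `η`
have no constant term. -/
def pullback (φ : Morphism U U') (f : U'.Series) : U.Series := fun L =>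
  ∑ᶠ m : (Fin U'.dim →₀ ℕ) × (Fin U'.numEven →₀ ℕ) × Finset (Fin U'.numOdd),
    MvPowerSeries.coeff L (φ.pullbackTerm f m.1 m.2.1 m.2.2)

/-- All components of the morphism `φ` belong to the class of functions `C`. -/
def IsOfType (φ : Morphism U U') (C : ∀ U : GradedDomain, Set U.Series) : Prop :=
  (∀ i, φ.x i ∈ C U) ∧ (∀ a, φ.ζ a ∈ C U) ∧ ∀ b, φ.η b ∈ C U

end Morphism

/-- A class of functions `C` (a set of formal power series on every `U`) is stable under
degree-preserving morphisms of the same type if pulling back functions of the class `C` along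
a degree-preserving morphism whose components belong to `C` yields functions of the class `C`. -/
def IsStable (C : ∀ U : GradedDomain, Set U.Series) : Prop :=
  ∀ (U U' : GradedDomain) (φ : Morphism U U'), φ.IsOfType C →
    ∀ f ∈ C U', φ.pullback f ∈ C U

end GradedDomain

end

/-! A series is in $\mathcal F(U)$ exactly when its monomials have only finitely many degrees. This
gives $\mathcal P\subseteq\mathcal F$ at once. Closure under products follows from additivity of
degree. That is checked with the algebra endomorphism $\eta_b\mapsto 2^{\deg\eta_b}\eta_b$, whose
eigenvalues read off the odd degree, so no product of two odd monomials is ever expanded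
(`mem_homogeneous_iff_oddScale`). Stability holds because every term of a pullback has the degree of
the monomial $\zeta^I\eta^J$ it comes from, so the pullback acquires no new degrees.

For minimality, every $f\in\mathcal F(U)$ is shown to be the pullback of a polynomial along a
morphism with polynomial components. There are finitely many sets $J$, so the exponents $I$
occurring in $f$ have finitely many even degrees. By the lemmas of Gordan and Dickson
(`Finsupp.exists_generators_of_map_mem`) they have the form $I=m+\sum_j\alpha_jw_j$ with $m$ in a
finite set $M$ and finitely many nonzero $w_j$ of degree $0$. Hence $f=\sum_{m\in
M,J}F_{mJ}(x,\zeta^{w_1},\dots,\zeta^{w_r})\,\zeta^m\eta^J$, where $F_{mJ}(x,y)$ is a formal power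
series in $y$ with smooth coefficients. Borel's lemma with parameters
(`exists_eventuallyEq_tsum_of_homogeneous`, `exists_iteratedPDeriv_eq`) realizes $F_{mJ}$ as the
Taylor series along $y=0$ of a smooth function $G_{mJ}$ on $U_0\times\mathbb R^r$. The polynomial
$\sum G_{mJ}\zeta^m\eta^J$ then pulls back to $f$ under $y_j\mapsto\zeta^{w_j}$
(`exists_pullback_eq`). -/

noncomputable section

/-! ### Monomial basis of the exterior algebra as ordered products -/

/-- The alternating product over a list in which only the members of `J` contribute. -/
theorem List.prod_map_ite_mem {ι A : Type*} [Monoid A] [DecidableEq ι] (x : ι → A)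
    (J : Finset ι) (l : List ι) :
    (l.map fun b => if b ∈ J then x b else 1).prod = ((l.filter (· ∈ J)).map x).prod := by
  induction l with
  | nil => simp
  | cons a l ih => by_cases h : a ∈ J <;> simp [h, ih]

theorem List.prod_map_ite_smul {ι R A : Type*} [CommSemiring R] [Semiring A] [Algebra R A]
    [DecidableEq ι] (c : ι → R) (x : ι → A) (J : Finset ι) (l : List ι) :
    (l.map fun b => if b ∈ J then c b • x b else 1).prod =
      (l.map fun b => if b ∈ J then c b else 1).prod •
        (l.map fun b => if b ∈ J then x b else 1).prod := by
  induction l with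
  | nil => simp
  | cons a l ih =>
    by_cases h : a ∈ J
    · simp only [List.map_cons, List.prod_cons, if_pos h, ih, smul_mul_smul_comm]
    · simp [h, ih]

theorem Fin.filter_finRange_mem {q : ℕ} (J : Finset (Fin q)) :
    (List.finRange q).filter (· ∈ J) = J.sort (· ≤ ·) := by
  refine List.Perm.eq_of_pairwise (le := (· ≤ ·)) (fun a b _ _ => le_antisymm) ?_
    (Finset.pairwise_sort _ _) ?_
  · exact (List.pairwise_le_finRange q).filter _
  · rw [List.perm_ext_iff_of_nodup ((List.nodup_finRange q).filter _) (Finset.sort_nodup _ _)]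
    simp

theorem Finset.ofFn_orderEmbOfFin {ι : Type*} [LinearOrder ι] (J : Finset ι) :
    List.ofFn (J.orderEmbOfFin rfl) = J.sort (· ≤ ·) := by
  refine List.ext_get (by simp) fun n h1 h2 => ?_
  simp [Finset.orderEmbOfFin_apply]

/-- The basis of the exterior algebra consists of the ordered products of basis vectors. -/
theorem ExteriorAlgebra.basis_eq_prod_ofFn {R M : Type*} [CommRing R] [AddCommGroup M]
    [Module R M] {q : ℕ} (b : Module.Basis (Fin q) R M) (J : Finset (Fin q)) :
    b.ExteriorAlgebra J =
      (List.ofFn fun i => if i ∈ J then ExteriorAlgebra.ι R (b i) else 1).prod := by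
  rw [ExteriorAlgebra.basis_apply_ofCard b rfl, ExteriorAlgebra.ιMulti_family,
    ExteriorAlgebra.ιMulti_apply,
    List.ofFn_eq_map, List.ofFn_eq_map,
    List.prod_map_ite_mem (fun i => ExteriorAlgebra.ι R (b i)), Fin.filter_finRange_mem,
    ← Finset.ofFn_orderEmbOfFin, List.ofFn_eq_map, List.map_map]
  rfl

namespace GradedDomain

variable (U : GradedDomain)

/-- The exterior algebra in the odd coordinates. -/
abbrev OddAlgebra : Type := ExteriorAlgebra U.Smooth (Fin U.numOdd → U.Smooth)

/-- The odd coordinate with index `b`. -/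
def theta (b : Fin U.numOdd) : U.OddAlgebra :=
  ExteriorAlgebra.ι U.Smooth (Pi.basisFun U.Smooth (Fin U.numOdd) b)

/-- The basis of monomials in the odd coordinates. -/
def oddBasis : Module.Basis (Finset (Fin U.numOdd)) U.Smooth U.OddAlgebra :=
  (Pi.basisFun U.Smooth (Fin U.numOdd)).ExteriorAlgebra

theorem oddBasis_eq_prod (J : Finset (Fin U.numOdd)) :
    U.oddBasis J = (List.ofFn fun b => if b ∈ J then U.theta b else 1).prod :=
  ExteriorAlgebra.basis_eq_prod_ofFn _ J

theorem oddBasis_empty : U.oddBasis ∅ = 1 := by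
  rw [oddBasis_eq_prod]; simp

theorem coef_apply (I : Fin U.numEven →₀ ℕ) (J : Finset (Fin U.numOdd)) (f : U.Series) :
    U.coef I J f = U.oddBasis.coord J (MvPowerSeries.coeff I f) := rfl

/-- Two series with the same coefficients are equal. -/
theorem series_ext {f g : U.Series} (h : ∀ I J, U.coef I J f = U.coef I J g) : f = g := by
  ext1 I
  refine U.oddBasis.ext_elem fun J => ?_
  exact h I J

/-! ### Detecting degrees by scaling with powers of two -/

/-- The constant function `2 ^ k`. -/
def twoPow (k : ℤ) : U.Smooth := algebraMap ℝ U.Smooth ((2 : ℝ) ^ k)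

theorem twoPow_add (k l : ℤ) : U.twoPow (k + l) = U.twoPow k * U.twoPow l := by
  rw [twoPow, zpow_add₀ two_ne_zero, map_mul, twoPow, twoPow]

theorem twoPow_zero : U.twoPow 0 = 1 := by simp [twoPow]

theorem twoPow_sum {ι : Type*} (s : Finset ι) (d : ι → ℤ) :
    U.twoPow (∑ i ∈ s, d i) = ∏ i ∈ s, U.twoPow (d i) := by
  classical
  induction s using Finset.induction_on with
  | empty => simp [twoPow_zero]
  | insert a s ha ih => rw [Finset.sum_insert ha, Finset.prod_insert ha, twoPow_add, ih]

/-- Evaluate at a point where `c` does not vanish: there $2^k=2^l$ forces $k=l$. The ring of smooth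
functions has zero divisors, but $2^k$ is a constant. -/
theorem twoPow_mul_eq_iff {k l : ℤ} {c : U.Smooth} :
    U.twoPow k * c = U.twoPow l * c ↔ (c ≠ 0 → k = l) := by
  constructor
  · intro h hc
    obtain ⟨y, hy⟩ : ∃ y, c y ≠ 0 := by
      by_contra! h0
      exact hc (ContMDiffMap.ext h0)
    have h1 : (2 : ℝ) ^ k * c y = (2 : ℝ) ^ l * c y := DFunLike.congr_fun h y
    exact zpow_right_injective₀ (by norm_num) (by norm_num) (mul_right_cancel₀ hy h1)
  · intro h
    by_cases hc : c = 0
    · simp [hc]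
    · rw [h hc]

/-- The algebra endomorphism multiplying the odd coordinate `b` by `2 ^ deg b`. -/
def oddScale : U.OddAlgebra →ₐ[U.Smooth] U.OddAlgebra :=
  ExteriorAlgebra.map (LinearMap.pi fun b => U.twoPow (U.oddDeg b) • LinearMap.proj b)

theorem oddScale_theta (b : Fin U.numOdd) :
    U.oddScale (U.theta b) = U.twoPow (U.oddDeg b) • U.theta b := by
  rw [oddScale, theta, ExteriorAlgebra.map_apply_ι, ← map_smul]
  congr 1
  ext1 c
  by_cases h : b = c
  · subst h; simp
  · simp [Ne.symm h]

theorem oddScale_oddBasis (J : Finset (Fin U.numOdd)) :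
    U.oddScale (U.oddBasis J) = U.twoPow (∑ b ∈ J, U.oddDeg b) • U.oddBasis J := by
  rw [oddBasis_eq_prod, map_list_prod, List.ofFn_eq_map, List.map_map]
  have h : (U.oddScale ∘ fun b => if b ∈ J then U.theta b else 1) =
      fun b => if b ∈ J then U.twoPow (U.oddDeg b) • U.theta b else 1 := by
    ext1 b
    by_cases hb : b ∈ J <;> simp [hb, oddScale_theta]
  rw [h, List.prod_map_ite_smul, ← List.ofFn_eq_map, List.prod_ofFn, Finset.prod_ite_mem,
    Finset.univ_inter, twoPow_sum]

theorem coord_oddScale (J : Finset (Fin U.numOdd)) (a : U.OddAlgebra) :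
    U.oddBasis.coord J (U.oddScale a) =
      U.twoPow (∑ b ∈ J, U.oddDeg b) * U.oddBasis.coord J a := by
  have h : U.oddBasis.coord J ∘ₗ U.oddScale.toLinearMap =
      U.twoPow (∑ b ∈ J, U.oddDeg b) • U.oddBasis.coord J := by
    refine U.oddBasis.ext fun K => ?_
    by_cases hK : K = J
    · subst hK; simp [oddScale_oddBasis]
    · simp [oddScale_oddBasis, hK]
  exact LinearMap.congr_fun h a

/-- The total degree of the monomial `ζ ^ I`. -/
def evenMonomialDeg : (Fin U.numEven →₀ ℕ) →+ ℤ where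
  toFun I := ∑ a, (I a : ℤ) * U.evenDeg a
  map_zero' := by simp
  map_add' I J := by simp [add_mul, Finset.sum_add_distrib]

theorem monomialDeg_eq (I : Fin U.numEven →₀ ℕ) (J : Finset (Fin U.numOdd)) :
    U.monomialDeg I J = U.evenMonomialDeg I + ∑ b ∈ J, U.oddDeg b := rfl

theorem mem_homogeneous {k : ℤ} {f : U.Series} :
    f ∈ U.homogeneous k ↔ ∀ I J, U.coef I J f ≠ 0 → U.monomialDeg I J = k := Iff.rfl

/-- Only the odd variables are scaled; the even degree of $\zeta^I$ is known for each coefficient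
and is subtracted from `k`. Homogeneity becomes an eigenvector condition for an algebra map, hence
visibly multiplicative. -/
theorem mem_homogeneous_iff_oddScale {k : ℤ} {f : U.Series} :
    f ∈ U.homogeneous k ↔ ∀ I, U.oddScale (MvPowerSeries.coeff I f) =
      U.twoPow (k - U.evenMonomialDeg I) • MvPowerSeries.coeff I f := by
  rw [mem_homogeneous]
  refine forall_congr' fun I => ?_
  rw [U.oddBasis.ext_elem_iff]
  refine forall_congr' fun J => ?_
  rw [← U.oddBasis.coord_apply, ← U.oddBasis.coord_apply, coord_oddScale, map_smul, smul_eq_mul,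
    twoPow_mul_eq_iff, monomialDeg_eq, coef_apply, eq_sub_iff_add_eq, add_comm]

theorem mul_mem_homogeneous {k l : ℤ} {f g : U.Series} (hf : f ∈ U.homogeneous k)
    (hg : g ∈ U.homogeneous l) : f * g ∈ U.homogeneous (k + l) := by
  classical
  rw [mem_homogeneous_iff_oddScale] at hf hg ⊢
  intro I
  rw [MvPowerSeries.coeff_mul, map_sum, Finset.smul_sum]
  refine Finset.sum_congr rfl fun x hx => ?_
  rw [map_mul, hf, hg, smul_mul_smul_comm, ← twoPow_add, ← Finset.HasAntidiagonal.mem_antidiagonal.1 hx, map_add,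
    sub_add_sub_comm]

theorem ofSmooth_mem_homogeneous (g : U.Smooth) : U.ofSmooth g ∈ U.homogeneous 0 := by
  classical
  rw [mem_homogeneous_iff_oddScale]
  intro I
  rw [ofSmooth, MvPowerSeries.algebraMap_apply, MvPowerSeries.coeff_C]
  split_ifs with h
  · subst h
    simp [twoPow_zero]
  · simp

theorem one_mem_homogeneous : (1 : U.Series) ∈ U.homogeneous 0 := by
  have := U.ofSmooth_mem_homogeneous 1
  rwa [ofSmooth, map_one] at this

theorem pow_mem_homogeneous {k : ℤ} {f : U.Series} (hf : f ∈ U.homogeneous k) (n : ℕ) :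
    f ^ n ∈ U.homogeneous (n * k) := by
  induction n with
  | zero => simpa using U.one_mem_homogeneous
  | succ n ih =>
    rw [pow_succ]
    have h : ((n + 1 : ℕ) : ℤ) * k = n * k + k := by push_cast; ring
    rw [h]
    exact U.mul_mem_homogeneous ih hf

theorem list_prod_mem_homogeneous {ι : Type*} {f : ι → U.Series} {d : ι → ℤ} (l : List ι)
    (h : ∀ i, f i ∈ U.homogeneous (d i)) :
    (l.map f).prod ∈ U.homogeneous (l.map d).sum := by
  induction l with
  | nil => simpa using U.one_mem_homogeneous
  | cons a l ih => simpa using U.mul_mem_homogeneous (h a) ih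

theorem prod_ofFn_mem_homogeneous {n : ℕ} {f : Fin n → U.Series} {d : Fin n → ℤ}
    (h : ∀ i, f i ∈ U.homogeneous (d i)) :
    (List.ofFn f).prod ∈ U.homogeneous (∑ i, d i) := by
  have := U.list_prod_mem_homogeneous (List.finRange n) h
  rwa [← List.ofFn_eq_map, ← List.ofFn_eq_map, List.sum_ofFn] at this

/-- The series with coefficients `c I J`. -/
def ofCoef (c : (Fin U.numEven →₀ ℕ) → Finset (Fin U.numOdd) → U.Smooth) : U.Series :=
  fun I => ∑ J, c I J • U.oddBasis J

theorem coef_ofCoef (c : (Fin U.numEven →₀ ℕ) → Finset (Fin U.numOdd) → U.Smooth)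
    (I : Fin U.numEven →₀ ℕ) (J : Finset (Fin U.numOdd)) : U.coef I J (U.ofCoef c) = c I J := by
  have h : MvPowerSeries.coeff I (U.ofCoef c) = ∑ J, c I J • U.oddBasis J := rfl
  rw [coef_apply, h, map_sum]
  simp_rw [map_smul, Module.Basis.coord_apply, Module.Basis.repr_self, Finsupp.single_apply]
  simp

/-! ### Graded functions: finitely many degrees, closure under products -/

/-- The graded functions are the series whose monomials have finitely many degrees. -/
theorem mem_gradedFunctions {f : U.Series} :
    f ∈ U.gradedFunctions ↔
      ∃ K : Finset ℤ, ∀ I J, U.coef I J f ≠ 0 → U.monomialDeg I J ∈ K := by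
  classical
  constructor
  · intro h
    refine Submodule.iSup_induction _ (motive := fun f => ∃ K : Finset ℤ, ∀ I J,
      U.coef I J f ≠ 0 → U.monomialDeg I J ∈ K) h ?_ ⟨∅, fun I J h => absurd (map_zero _) h⟩ ?_
    · intro k f hf
      exact ⟨{k}, fun I J h => by simpa using hf I J h⟩
    · rintro f g ⟨K, hK⟩ ⟨L, hL⟩
      refine ⟨K ∪ L, fun I J h => ?_⟩
      by_contra hn
      rw [Finset.mem_union, not_or] at hn
      refine h ?_
      rw [map_add, not_not.1 (mt (hK I J) hn.1), not_not.1 (mt (hL I J) hn.2), add_zero]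
  · rintro ⟨K, hK⟩
    -- The homogeneous component of `f` of degree `k`.
    let p : ℤ → U.Series := fun k =>
      U.ofCoef fun I J => if U.monomialDeg I J = k then U.coef I J f else 0
    have hp : ∀ k I J, U.coef I J (p k) =
        if U.monomialDeg I J = k then U.coef I J f else 0 := fun k => U.coef_ofCoef _
    have hf : f = ∑ k ∈ K, p k := by
      refine U.series_ext fun I J => ?_
      rw [map_sum]
      simp only [hp, Finset.sum_ite_eq]
      split_ifs with h
      · rfl
      · exact not_not.1 (mt (hK I J) h)
    rw [hf]
    refine Submodule.sum_mem _ fun k _ => Submodule.mem_iSup_of_mem k fun I J h => ?_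
    rw [hp] at h
    by_contra hk
    exact h (if_neg hk)

theorem mul_mem_gradedFunctions {f g : U.Series} (hf : f ∈ U.gradedFunctions)
    (hg : g ∈ U.gradedFunctions) : f * g ∈ U.gradedFunctions := by
  refine Submodule.iSup_induction _ (motive := fun f => f * g ∈ U.gradedFunctions) hf ?_
    (by simp) fun a b ha hb => by rw [add_mul]; exact add_mem ha hb
  intro k a ha
  refine Submodule.iSup_induction _ (motive := fun g => a * g ∈ U.gradedFunctions) hg ?_
    (by simp) fun c d hc hd => by rw [mul_add]; exact add_mem hc hd
  intro l c hc
  exact Submodule.mem_iSup_of_mem (k + l) (U.mul_mem_homogeneous ha hc)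

/-- The subalgebra of graded functions. -/
def gradedFunctionsSubalgebra : Subalgebra ℝ U.Series where
  carrier := U.gradedFunctions
  mul_mem' := U.mul_mem_gradedFunctions
  add_mem' := U.gradedFunctions.add_mem
  algebraMap_mem' c := by
    have h : algebraMap ℝ U.Series c = U.ofSmooth (algebraMap ℝ U.Smooth c) :=
      IsScalarTower.algebraMap_apply ℝ U.Smooth U.Series c
    rw [SetLike.mem_coe, h]
    exact Submodule.mem_iSup_of_mem 0 (U.ofSmooth_mem_homogeneous _)

theorem polynomials_subset_gradedFunctions :
    U.polynomials ⊆ (U.gradedFunctions : Set U.Series) := by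
  intro f hf
  refine U.mem_gradedFunctions.2
    ⟨(hf.image fun IJ => U.monomialDeg IJ.1 IJ.2).toFinset, fun I J h => ?_⟩
  rw [Set.Finite.mem_toFinset]
  exact ⟨(I, J), h, rfl⟩

variable {U} {U' : GradedDomain}

/-- The Taylor factors $(\varphi^*x'-x_0)^\alpha$ and the smooth coefficient have degree $0$, so the
degree comes from $(\varphi^*\zeta')^I(\varphi^*\eta')^J$ alone. -/
theorem Morphism.pullbackTerm_mem_homogeneous (φ : Morphism U U') (f : U'.Series)
    (α : Fin U'.dim →₀ ℕ) (I : Fin U'.numEven →₀ ℕ) (J : Finset (Fin U'.numOdd)) :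
    φ.pullbackTerm f α I J ∈ U.homogeneous (U'.monomialDeg I J) := by
  have h1 := U.prod_ofFn_mem_homogeneous (d := fun i => (α i : ℤ) * 0) fun i =>
    U.pow_mem_homogeneous ((U.homogeneous 0).sub_mem (φ.x_mem i)
      (U.ofSmooth_mem_homogeneous (U.body (φ.x i)))) (α i)
  have h2 := U.prod_ofFn_mem_homogeneous fun a => U.pow_mem_homogeneous (φ.ζ_mem a) (I a)
  have h3 := U.prod_ofFn_mem_homogeneous (f := fun b => if b ∈ J then φ.η b else 1)
    (d := fun b => if b ∈ J then U'.oddDeg b else 0) fun b => by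
      split_ifs
      · exact φ.η_mem b
      · exact U.one_mem_homogeneous
  have h := U.mul_mem_homogeneous (U.mul_mem_homogeneous (U.mul_mem_homogeneous
    (U.ofSmooth_mem_homogeneous ((∏ i, ((α i).factorial : ℝ))⁻¹ •
      φ.baseComp (U'.iteratedPDeriv α (U'.coef I J f)))) h1) h2) h3
  rw [Morphism.pullbackTerm]
  convert h using 1
  simp [monomialDeg]

theorem Morphism.pullbackTerm_of_coef_eq_zero (φ : Morphism U U') {f : U'.Series}
    (α : Fin U'.dim →₀ ℕ) {I : Fin U'.numEven →₀ ℕ} {J : Finset (Fin U'.numOdd)}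
    (h : φ.baseComp (U'.iteratedPDeriv α (U'.coef I J f)) = 0) :
    φ.pullbackTerm f α I J = 0 := by
  rw [pullbackTerm, h, smul_zero, ofSmooth, map_zero, zero_mul, zero_mul, zero_mul]

theorem pderiv_zero (i : Fin U.dim) : U.pderiv i 0 = 0 := by
  ext y
  have h : U.extend 0 = 0 := by
    ext z
    by_cases hz : ∃ y : U.base, (y : EuclideanSpace ℝ (Fin U.dim)) = z
    · obtain ⟨y, rfl⟩ := hz
      exact U.extend_apply 0 y
    · exact Function.extend_apply' _ _ _ hz
  change fderiv ℝ (U.extend 0) y (EuclideanSpace.single i 1) = 0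
  rw [h]
  simp

theorem iteratedPDeriv_zero (α : Fin U.dim →₀ ℕ) : U.iteratedPDeriv α 0 = 0 := by
  rw [iteratedPDeriv]
  induction List.finRange U.dim with
  | nil => rfl
  | cons i l ih =>
    rw [List.foldr_cons, ih]
    exact Function.iterate_fixed (pderiv_zero i) _

theorem Morphism.baseComp_zero (φ : Morphism U U') : φ.baseComp 0 = 0 := rfl

theorem Morphism.pullback_mem_gradedFunctions (φ : Morphism U U') {f : U'.Series}
    (hf : f ∈ U'.gradedFunctions) : φ.pullback f ∈ U.gradedFunctions := by
  obtain ⟨K, hK⟩ := U'.mem_gradedFunctions.1 hf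
  refine U.mem_gradedFunctions.2 ⟨K, fun I J h => ?_⟩
  have h1 : MvPowerSeries.coeff I (φ.pullback f) =
    ∑ᶠ m : (Fin U'.dim →₀ ℕ) × (Fin U'.numEven →₀ ℕ) × Finset (Fin U'.numOdd),
      MvPowerSeries.coeff I (φ.pullbackTerm f m.1 m.2.1 m.2.2) := rfl
  rw [coef_apply, h1] at h
  by_contra hn
  -- The induction also covers the default value $0$ of a `finsum` with infinite support, so local
  -- finiteness of the substitution is not needed here.
  refine h (finsum_induction (fun a => U.oddBasis.coord J a = 0) (map_zero _)
    (fun a b ha hb => by rw [map_add, ha, hb, add_zero]) fun m => ?_)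
  by_contra hm
  -- A term contributing at $(I,J)$ comes from a monomial of the same degree. That degree lies
  -- outside `K`, so the coefficient of `f` there is zero.
  have hm1 := φ.pullbackTerm_mem_homogeneous f m.1 m.2.1 m.2.2 I J hm
  refine hm ?_
  rw [φ.pullbackTerm_of_coef_eq_zero, map_zero, map_zero]
  rw [not_not.1 (mt (hK m.2.1 m.2.2) (hm1 ▸ hn)), iteratedPDeriv_zero, baseComp_zero]

end GradedDomain

/-! ### Finite generation of exponents of bounded degree -/

/-- The vectors in `ℕ ^ p` at which an additive functional takes one of finitely many values form
a finitely generated module over the monoid of its zeros, which is itself finitely generated. -/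
theorem Finsupp.exists_generators_of_map_mem {σ : Type*} [Finite σ] (d : (σ →₀ ℕ) →+ ℤ)
    (K : Finset ℤ) :
    ∃ (r : ℕ) (w : Fin r → σ →₀ ℕ) (M : Finset (σ →₀ ℕ)), (∀ i, w i ≠ 0) ∧ (∀ i, d (w i) = 0) ∧
      ∀ I, d I ∈ K → ∃ m ∈ M, ∃ α : Fin r → ℕ, I = m + ∑ i, α i • w i := by
  classical
  obtain ⟨S, hS⟩ := AddSubmonoid.fg_eqLocusM d 0
  have hker : ∀ I, I ∈ AddMonoidHom.eqLocusM d 0 ↔ d I = 0 := fun I => Iff.rfl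
  -- Dickson's lemma: minimal elements form an antichain in a well-quasi-order.
  have hfin : ∀ k : ℤ, {m | Minimal (fun I => d I = k) m}.Finite := fun k =>
    WellQuasiOrderedLE.finite_of_isAntichain (setOfPred_minimal_antichain _)
  -- Removing $0$ from the generators makes each $\zeta^{w_i}$ a nonconstant monomial.
  refine ⟨(S.erase 0).card, fun i => (S.erase 0).equivFin.symm i,
    K.biUnion fun k => (hfin k).toFinset, fun i => (Finset.mem_erase.1 (Subtype.prop _)).1,
    fun i => ?_, fun I hI => ?_⟩
  · rw [← hker, ← hS]
    exact AddSubmonoid.subset_closure (Finset.mem_erase.1 (Subtype.prop _)).2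
  · obtain ⟨m, hm, hmin⟩ := exists_minimal_le_of_wellFoundedLT (fun x => d x = d I) I rfl
    refine ⟨m, Finset.mem_biUnion.2 ⟨d I, hI, (hfin _).mem_toFinset.2 hmin⟩, ?_⟩
    have h0 : I - m ∈ AddSubmonoid.closure ((S.erase 0 : Finset (σ →₀ ℕ)) : Set (σ →₀ ℕ)) := by
      rw [Finset.coe_erase, AddSubmonoid.closure_sdiff_singleton_zero, hS, hker]
      have := map_add d m (I - m)
      rw [add_tsub_cancel_of_le hm, hmin.1] at this
      linarith
    obtain ⟨f, hf⟩ := AddSubmonoid.mem_closure_finset'.1 h0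
    refine ⟨fun i => f ((S.erase 0).equivFin.symm i), ?_⟩
    rw [Equiv.sum_comp (S.erase 0).equivFin.symm (fun x => f x • (x : σ →₀ ℕ)), ← hf,
      add_tsub_cancel_of_le hm]

/-! ### Borel's lemma with parameters -/

section Borel

open Filter Topology

variable {E X T : Type*} [NormedAddCommGroup E] [NormedSpace ℝ E] [NormedAddCommGroup X]
  [NormedSpace ℝ X] [NormedAddCommGroup T] [NormedSpace ℝ T]

/-- A smooth function all of whose iterated derivatives are bounded. -/
def HasBoundedDerivs (f : E → ℝ) : Prop :=
  ContDiff ℝ ∞ f ∧ ∀ k : ℕ, ∃ C : ℝ, ∀ z, ‖iteratedFDeriv ℝ k f z‖ ≤ C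

theorem HasBoundedDerivs.of_hasCompactSupport {f : E → ℝ} (hf : ContDiff ℝ ∞ f)
    (hc : HasCompactSupport f) : HasBoundedDerivs f :=
  ⟨hf, fun k => (hf.continuous_iteratedFDeriv (m := k) (by exact_mod_cast le_top)
    ).bounded_above_of_compact_support (hc.iteratedFDeriv k)⟩

theorem norm_iteratedFDeriv_comp_clm_le {f : X → ℝ} (hf : ContDiff ℝ ∞ f) (p : E →L[ℝ] X) (k : ℕ)
    (z : E) : ‖iteratedFDeriv ℝ k (fun y => f (p y)) z‖ ≤
      ‖iteratedFDeriv ℝ k f (p z)‖ * ‖p‖ ^ k := by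
  have h := p.iteratedFDeriv_comp_right hf z (i := k) (by exact_mod_cast le_top)
  have h' : iteratedFDeriv ℝ k (fun y => f (p y)) z = _ := h
  rw [h']
  refine (ContinuousMultilinearMap.norm_compContinuousLinearMap_le _ _).trans ?_
  simp

theorem HasBoundedDerivs.comp_clm {f : X → ℝ} (hf : HasBoundedDerivs f) (p : E →L[ℝ] X) :
    HasBoundedDerivs fun z => f (p z) := by
  refine ⟨hf.1.comp p.contDiff, fun k => ?_⟩
  obtain ⟨C, hC⟩ := hf.2 k
  exact ⟨C * ‖p‖ ^ k, fun z => (norm_iteratedFDeriv_comp_clm_le hf.1 p k z).trans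
    (mul_le_mul_of_nonneg_right (hC _) (by positivity))⟩

theorem HasBoundedDerivs.mul {f g : E → ℝ} (hf : HasBoundedDerivs f) (hg : HasBoundedDerivs g) :
    HasBoundedDerivs fun z => f z * g z := by
  refine ⟨hf.1.mul hg.1, fun k => ?_⟩
  choose C hC using hf.2
  choose D hD using hg.2
  refine ⟨∑ i ∈ Finset.range (k + 1), (k.choose i) * C i * D (k - i), fun z =>
    (norm_iteratedFDeriv_mul_le hf.1 hg.1 z (n := k) (by exact_mod_cast le_top)).trans ?_⟩
  have hC0 : ∀ i, 0 ≤ C i := fun i => (norm_nonneg _).trans (hC i z)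
  gcongr
  · exact mul_nonneg (Nat.cast_nonneg _) (hC0 _)
  · exact hC _ z
  · exact hD _ z

theorem HasBoundedDerivs.const_mul {f : E → ℝ} (hf : HasBoundedDerivs f) (c : ℝ) :
    HasBoundedDerivs fun z => c * f z := by
  refine ⟨contDiff_const.mul hf.1, fun k => ?_⟩
  obtain ⟨C, hC⟩ := hf.2 k
  refine ⟨‖c‖ * C, fun z => ?_⟩
  have h : iteratedFDeriv ℝ k (fun z => c * f z) z = c • iteratedFDeriv ℝ k f z :=
    iteratedFDeriv_const_smul_apply (a := c) (f := f)
      ((hf.1.of_le (by exact_mod_cast le_top)).contDiffAt)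
  rw [h, norm_smul]
  exact mul_le_mul_of_nonneg_left (hC z) (norm_nonneg _)

/-- Rescaling a function with weight `c ^ (-N)` makes its derivatives of order below `N` small. -/
theorem eventually_norm_iteratedFDeriv_mul_scale_le {A H : E → ℝ} (hA : HasBoundedDerivs A)
    (hH : HasBoundedDerivs H) {k N : ℕ} (hk : k < N) {ε : ℝ} (hε : 0 < ε) :
    ∀ᶠ c : ℝ in atTop, ∀ z,
      ‖iteratedFDeriv ℝ k (fun z => A z * ((c ^ N)⁻¹ * H (c • z))) z‖ ≤ ε := by
  choose C hC using hA.2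
  choose D hD using hH.2
  have hC0 : ∀ i, 0 ≤ C i := fun i => (norm_nonneg _).trans (hC i 0)
  have hD0 : ∀ i, 0 ≤ D i := fun i => (norm_nonneg _).trans (hD i 0)
  set S : ℝ := ∑ i ∈ Finset.range (k + 1), (k.choose i) * C i * D (k - i) with hS
  filter_upwards [eventually_ge_atTop 1, eventually_ge_atTop (S / ε)] with c hc1 hc2 z
  have hc0 : 0 < c := one_pos.trans_le hc1
  have hscale : ContDiff ℝ ∞ fun z : E => (c ^ N)⁻¹ * H (c • z) :=
    contDiff_const.mul (hH.1.comp (contDiff_const_smul c))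
  -- A derivative of order $j<N$ costs a factor $c^j\le c^{N-1}$, so the weight $c^{-N}$ leaves
  -- $1/c$.
  have hbound : ∀ j < N, ‖iteratedFDeriv ℝ j (fun z => (c ^ N)⁻¹ * H (c • z)) z‖ ≤ D j / c := by
    intro j hj
    have h1 : iteratedFDeriv ℝ j (fun z => (c ^ N)⁻¹ * H (c • z)) z =
        (c ^ N)⁻¹ • iteratedFDeriv ℝ j (fun z => H (c • z)) z :=
      iteratedFDeriv_const_smul_apply (a := (c ^ N)⁻¹) (f := fun z => H (c • z))
        (((hH.1.comp (contDiff_const_smul c)).of_le (by exact_mod_cast le_top)).contDiffAt)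
    have h2 : ‖iteratedFDeriv ℝ j (fun z => H (c • z)) z‖ ≤ D j * c ^ j := by
      refine (norm_iteratedFDeriv_comp_clm_le hH.1 (c • ContinuousLinearMap.id ℝ E) j z).trans ?_
      have h3 : ‖c • ContinuousLinearMap.id ℝ E‖ ≤ c := by
        rw [norm_smul, Real.norm_of_nonneg hc0.le]
        exact mul_le_of_le_one_right hc0.le ContinuousLinearMap.norm_id_le
      have := hD0 j
      gcongr
      exact hD _ _
    rw [h1, norm_smul, Real.norm_of_nonneg (by positivity), inv_mul_le_iff₀ (by positivity)]
    refine h2.trans ?_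
    have h4 : c ^ N * (D j / c) = D j * c ^ (N - 1) := by
      obtain ⟨M, rfl⟩ : ∃ M, N = M + 1 := ⟨N - 1, by omega⟩
      rw [Nat.add_sub_cancel, pow_succ]
      field_simp
    rw [h4]
    exact mul_le_mul_of_nonneg_left (pow_le_pow_right₀ hc1 (by omega)) (hD0 j)
  refine (norm_iteratedFDeriv_mul_le hA.1 hscale z (n := k) (by exact_mod_cast le_top)).trans ?_
  calc _ ≤ ∑ i ∈ Finset.range (k + 1), (k.choose i) * C i * (D (k - i) / c) := by
        refine Finset.sum_le_sum fun i _ => ?_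
        have := hC0 i
        gcongr
        · exact hC _ _
        · exact hbound _ (by omega)
    _ = S / c := by
        rw [hS, Finset.sum_div]
        exact Finset.sum_congr rfl fun i _ => by ring
    _ ≤ ε := by
        rw [div_le_iff₀ hc0]
        rwa [div_le_iff₀' hε] at hc2

/-- A family of smooth functions whose derivatives of each order have summable uniform bounds. -/
def SmoothSummable {ι : Type*} (u : ι → E → ℝ) : Prop :=
  (∀ i, ContDiff ℝ ∞ (u i)) ∧ ∀ k : ℕ, ∃ v : ι → ℝ, Summable v ∧
    ∀ i z, ‖iteratedFDeriv ℝ k (u i) z‖ ≤ v i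

/-- The derivative in the direction `v`. -/
def dirDeriv (v : E) (f : E → ℝ) : E → ℝ := fun z => fderiv ℝ f z v

theorem SmoothSummable.contDiff_tsum {ι : Type*} {u : ι → E → ℝ} (hu : SmoothSummable u) :
    ContDiff ℝ ∞ fun z => ∑' i, u i z := by
  choose v hv using hu.2
  exact _root_.contDiff_tsum (N := ⊤) hu.1 (fun k _ => (hv k).1) fun k i z _ => (hv k).2 i z

theorem SmoothSummable.map_dirDeriv {ι : Type*} {u : ι → E → ℝ} (hu : SmoothSummable u) (e : E) :
    SmoothSummable fun i => dirDeriv e (u i) := by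
  have h1 : ∀ i, ContDiff ℝ ∞ (fderiv ℝ (u i)) := fun i =>
    (hu.1 i).fderiv_right (m := ∞) le_rfl
  refine ⟨fun i => (h1 i).clm_apply contDiff_const, fun k => ?_⟩
  obtain ⟨v, hv, hb⟩ := hu.2 (k + 1)
  refine ⟨fun i => ‖e‖ * v i, hv.mul_left _, fun i z => ?_⟩
  refine (norm_iteratedFDeriv_clm_apply_const (h1 i).contDiffAt
    (by exact_mod_cast le_top)).trans ?_
  rw [norm_iteratedFDeriv_fderiv]
  exact mul_le_mul_of_nonneg_left (hb i z) (norm_nonneg _)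

theorem SmoothSummable.map_dirDeriv_tsum {ι : Type*} {u : ι → E → ℝ} (hu : SmoothSummable u) (e : E) :
    dirDeriv e (fun z => ∑' i, u i z) = fun z => ∑' i, dirDeriv e (u i) z := by
  obtain ⟨v, hv, hb⟩ := hu.2 1
  obtain ⟨v₀, hv₀, hb₀⟩ := hu.2 0
  have hb' : ∀ i z, ‖fderiv ℝ (u i) z‖ ≤ v i := fun i z => by
    rw [← norm_iteratedFDeriv_one]; exact hb i z
  have h := fderiv_tsum (x₀ := 0) hv (fun i => (hu.1 i).differentiable (by simp)) hb'
    (Summable.of_norm_bounded hv₀ fun i => by simpa using hb₀ i 0)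
  ext z
  rw [dirDeriv, h]
  exact (ContinuousLinearMap.apply ℝ ℝ e).map_tsum (Summable.of_norm_bounded hv fun i => hb' i z)

/-- An open set is exhausted by the regions where countably many smooth cutoff functions
supported in it are equal to `1`. -/
theorem exists_countable_cutoffs [FiniteDimensional ℝ X] {s : Set X} (hs : IsOpen s) :
    ∃ (t : Set X) (ψ : X → X → ℝ), t.Countable ∧ (∀ j ∈ t, ContDiff ℝ ∞ (ψ j)) ∧
      (∀ j ∈ t, HasCompactSupport (ψ j)) ∧ (∀ j ∈ t, tsupport (ψ j) ⊆ s) ∧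
      ∀ x ∈ s, ∃ j ∈ t, ψ j =ᶠ[𝓝 x] 1 := by
  have h1 : ∀ x ∈ s, ∃ f : ContDiffBump x, Metric.closedBall x f.rOut ⊆ s := by
    intro x hx
    obtain ⟨r, hr, hrs⟩ := Metric.nhds_basis_closedBall.mem_iff.1 (hs.mem_nhds hx)
    exact ⟨⟨r / 2, r, by linarith, by linarith⟩, hrs⟩
  choose! f hf using h1
  have : ProperSpace X := FiniteDimensional.proper ℝ X
  obtain ⟨t, hts, htc, hcov⟩ := TopologicalSpace.countable_cover_nhdsWithin
    (f := fun x => Metric.ball x (f x).rIn) (s := s)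
    fun x hx => mem_nhdsWithin_of_mem_nhds (Metric.ball_mem_nhds x (f x).rIn_pos)
  refine ⟨t, fun y => f y, htc, fun j _ => (f j).contDiff, fun j _ => (f j).hasCompactSupport,
    fun j hj => ?_, fun x hx => ?_⟩
  · rw [ContDiffBump.tsupport_eq]
    exact hf _ (hts hj)
  · obtain ⟨y, hy, hxy⟩ := Set.mem_iUnion₂.1 (hcov hx)
    exact ⟨y, hy, (f y).eventuallyEq_one_of_mem_ball hxy⟩

theorem contDiff_mul_of_tsupport_subset {s : Set X} {ψ g : X → ℝ} (hψ : ContDiff ℝ ∞ ψ)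
    (hs : tsupport ψ ⊆ s) (hg : ∀ x ∈ s, ContDiffAt ℝ ∞ g x) :
    ContDiff ℝ ∞ fun x => ψ x * g x := by
  rw [contDiff_iff_contDiffAt]
  intro x
  by_cases hx : x ∈ s
  · exact hψ.contDiffAt.mul (hg x hx)
  · have h : ψ =ᶠ[𝓝 x] 0 := notMem_tsupport_iff_eventuallyEq.1 fun h => hx (hs h)
    have h2 : (fun x => ψ x * g x) =ᶠ[𝓝 x] fun _ => 0 := by
      filter_upwards [h] with y hy
      simp [hy]
    exact contDiffAt_const.congr_of_eventuallyEq h2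

/-- For each order the finitely many exceptional members are bounded separately, and their bounds
are added to `v`. -/
theorem SmoothSummable.of_eventually_le {ι : Type*} {u : ι → E → ℝ}
    (hu : ∀ i, HasBoundedDerivs (u i)) {v : ι → ℝ} (hv : Summable v) (hv0 : ∀ i, 0 ≤ v i)
    (h : ∀ k : ℕ, ∀ᶠ i in cofinite, ∀ z, ‖iteratedFDeriv ℝ k (u i) z‖ ≤ v i) :
    SmoothSummable u := by
  classical
  refine ⟨fun i => (hu i).1, fun k => ?_⟩
  choose C hC using fun i => (hu i).2 k
  have hS := eventually_cofinite.1 (h k)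
  refine ⟨fun i => v i + if i ∈ hS.toFinset then C i else 0,
    hv.add (summable_of_ne_finset_zero (s := hS.toFinset) fun i hi => if_neg hi), fun i z => ?_⟩
  by_cases hi : i ∈ hS.toFinset
  · simp only [if_pos hi]
    exact (hC i z).trans (le_add_of_nonneg_left (hv0 i))
  · simp only [if_neg hi, add_zero]
    exact not_not.1 (fun hn => hi (hS.mem_toFinset.2 hn)) z

/-- **Borel's lemma with parameters.** For smooth coefficients `g i` on an open set and functions
`m i` on `T` homogeneous of degrees tending to infinity, there is a function which is locally the
sum of a smoothly summable family whose members agree with `g i * m i` near the zero section. -/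
theorem exists_eventuallyEq_tsum_of_homogeneous [FiniteDimensional ℝ X] [FiniteDimensional ℝ T]
    {ι : Type*} [Countable ι] {s : Set X} (hs : IsOpen s) {g : ι → X → ℝ}
    (hg : ∀ i, ∀ x ∈ s, ContDiffAt ℝ ∞ (g i) x) (p : E →L[ℝ] X) (q : E →L[ℝ] T)
    {m : ι → T → ℝ} (hm : ∀ i, ContDiff ℝ ∞ (m i)) {N : ι → ℕ}
    (hmN : ∀ i (c : ℝ) t, m i (c • t) = c ^ N i * m i t) (hN : ∀ k, {i | N i ≤ k}.Finite) :
    ∃ G : E → ℝ, ∀ z, p z ∈ s → ∃ u : ι → E → ℝ, SmoothSummable u ∧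
      G =ᶠ[𝓝 z] (fun y => ∑' i, u i y) ∧
      (q z = 0 → ∀ i, u i =ᶠ[𝓝 z] fun y => g i (p y) * m i (q y)) := by
  have := Encodable.ofCountable ι
  obtain ⟨J, ψ, hJ, hψ, hψc, hψs, hψ1⟩ := exists_countable_cutoffs hs
  have hJ' : Countable J := hJ.to_subtype
  have := Encodable.ofCountable J
  let χ : ContDiffBump (0 : T) := ⟨1, 2, one_pos, one_lt_two⟩
  let H : ι → E → ℝ := fun i z => m i (q z) * χ (q z)
  have hH : ∀ i, HasBoundedDerivs (H i) := fun i =>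
    (HasBoundedDerivs.of_hasCompactSupport (f := fun t => m i t * χ t)
      ((hm i).mul χ.contDiff) χ.hasCompactSupport.mul_left).comp_clm q
  have hA : ∀ (j : J) i, HasBoundedDerivs fun z : E => ψ j (p z) * g i (p z) := fun j i =>
    (HasBoundedDerivs.of_hasCompactSupport (f := fun x => ψ j x * g i x)
      (contDiff_mul_of_tsupport_subset (hψ j j.2) (hψs j j.2) (hg i))
      (hψc j j.2).mul_right).comp_clm p
  obtain ⟨ε, hε0, c, hε, -⟩ := posSumOfEncodable one_pos ι
  -- A diagonal choice: the scale of member `i` answers only to cutoffs `j` enumerated no later than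
  -- `i` and to orders below `N i`. These are finitely many conditions, each true for large `c`.
  -- Conversely, for fixed `j` and `k` all but finitely many `i` are controlled.
  have hscale : ∀ i, ∃ c : ℝ, 0 < c ∧ ∀ j : J, Encodable.encode j ≤ Encodable.encode i →
      ∀ k < N i, ∀ z, ‖iteratedFDeriv ℝ k
        (fun z => ψ j (p z) * g i (p z) * ((c ^ N i)⁻¹ * H i (c • z))) z‖ ≤ ε i := by
    intro i
    have hf1 : {j : J | Encodable.encode j ≤ Encodable.encode i}.Finite :=
      (Set.finite_Iic (Encodable.encode i)).preimage Encodable.encode_injective.injOn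
    have h := (eventually_gt_atTop (0 : ℝ)).and ((eventually_all_finite hf1).2 fun j _ =>
      (eventually_all_finite (Set.finite_Iio (N i))).2 fun k hk =>
        eventually_norm_iteratedFDeriv_mul_scale_le (hA j i) (hH i) hk (hε0 i))
    exact h.exists
  choose a ha0 ha using hscale
  -- The sum itself contains no base cutoff `ψ j`; one equal to $1$ near the given point is inserted
  -- afterwards, so a single global formula serves all of `s`.
  refine ⟨fun z => ∑' i, g i (p z) * ((a i ^ N i)⁻¹ * H i (a i • z)), fun z hz => ?_⟩
  obtain ⟨j, hjJ, hj⟩ := hψ1 (p z) hz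
  have hj' : ∀ᶠ y in 𝓝 z, ψ j (p y) = 1 := p.continuous.continuousAt.eventually hj
  refine ⟨fun i y => ψ j (p y) * g i (p y) * ((a i ^ N i)⁻¹ * H i (a i • y)), ?_, ?_, ?_⟩
  · refine SmoothSummable.of_eventually_le (v := ε) (fun i => (hA ⟨j, hjJ⟩ i).mul
      (((hH i).comp_clm (a i • ContinuousLinearMap.id ℝ E)).const_mul _)) hε.summable
      (fun i => (hε0 i).le) fun k => ?_
    have hf1 : {i : ι | Encodable.encode i < Encodable.encode (⟨j, hjJ⟩ : J)}.Finite :=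
      (Set.finite_Iio _).preimage Encodable.encode_injective.injOn
    filter_upwards [hf1.compl_mem_cofinite, (hN k).compl_mem_cofinite] with i h1 h2 z
    exact ha i ⟨j, hjJ⟩ (not_lt.1 h1) k (not_le.1 h2) z
  · filter_upwards [hj'] with y hy
    simp [hy]
  · intro hqz i
    -- Near the zero section the bump is $1$, and homogeneity of `m i` cancels the weight
    -- $a_i^{-N_i}$.
    have hχ : ∀ᶠ y in 𝓝 z, χ (q (a i • y)) = 1 := by
      have hc : ContinuousAt (fun y => q (a i • y)) z := by fun_prop
      refine hc.eventually (p := fun t => χ t = 1) ?_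
      have h0 : q (a i • z) = 0 := by rw [map_smul, hqz, smul_zero]
      change ∀ᶠ t in 𝓝 (q (a i • z)), χ t = 1
      rw [h0]
      exact χ.eventuallyEq_one
    filter_upwards [hj', hχ] with y hy1 hy2
    have := (ha0 i).ne'
    simp only [H, hy1, hy2]
    rw [map_smul, hmN]
    field_simp

end Borel

/-! ### Iterated directional derivatives -/

/-- Iterated application of families of operators preserves a relation preserved by them. -/
theorem List.foldr_iterate_rel {κ A B : Type*} {R : A → B → Prop} {f : κ → A → A} {g : κ → B → B}
    {β : κ → ℕ} (h : ∀ i, β i ≠ 0 → ∀ a b, R a b → R (f i a) (g i b)) (l : List κ) {a : A} {b : B}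
    (hab : R a b) :
    R (l.foldr (fun i u => (f i)^[β i] u) a) (l.foldr (fun i u => (g i)^[β i] u) b) := by
  induction l with
  | nil => exact hab
  | cons i l ih =>
    rw [List.foldr_cons, List.foldr_cons]
    by_cases hi : β i = 0
    · rwa [hi]
    · generalize β i = k
      induction k with
      | zero => exact ih
      | succ k ihk =>
        rw [Function.iterate_succ_apply', Function.iterate_succ_apply']
        exact h i hi _ _ ihk

theorem List.foldr_iterate_ite {κ A : Type*} [DecidableEq κ] (D : A → A) (β : κ → ℕ) (k : κ)
    {l : List κ} (hl : l.Nodup) (a : A) :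
    l.foldr (fun i u => (if i = k then D else id)^[β i] u) a =
      if k ∈ l then D^[β k] a else a := by
  induction l with
  | nil => rfl
  | cons i l ih =>
    rw [List.nodup_cons] at hl
    rw [List.foldr_cons, ih hl.2]
    by_cases h : i = k
    · subst h
      simp [hl.1]
    · simp [h, Ne.symm h]

section IteratedDirDeriv

open Filter Topology

variable {E X κ : Type*} [NormedAddCommGroup E] [NormedSpace ℝ E] [NormedAddCommGroup X]
  [NormedSpace ℝ X]

/-- The iterated derivative of orders `β` in the directions `e`. -/
def iteratedDirDeriv (e : κ → E) (β : κ → ℕ) (l : List κ) (f : E → ℝ) : E → ℝ :=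
  l.foldr (fun i u => (dirDeriv (e i))^[β i] u) f

theorem iteratedDirDeriv_congr (e : κ → E) (β : κ → ℕ) (l : List κ) {f g : E → ℝ} {z : E}
    (h : f =ᶠ[𝓝 z] g) : iteratedDirDeriv e β l f =ᶠ[𝓝 z] iteratedDirDeriv e β l g := by
  refine List.foldr_iterate_rel (R := fun f g : E → ℝ => f =ᶠ[𝓝 z] g) (fun i _ a b hab => ?_) l h
  filter_upwards [hab.fderiv (𝕜 := ℝ)] with y hy
  rw [dirDeriv, dirDeriv, hy]

/-- Smooth summability survives each differentiation, so it is carried in the relation along with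
the termwise formula. A second relation identifies the members of the differentiated family. -/
theorem SmoothSummable.iteratedDirDeriv_tsum {ι : Type*} {u : ι → E → ℝ} (hu : SmoothSummable u)
    (e : κ → E) (β : κ → ℕ) (l : List κ) :
    iteratedDirDeriv e β l (fun z => ∑' i, u i z) =
      fun z => ∑' i, iteratedDirDeriv e β l (u i) z := by
  have h := List.foldr_iterate_rel (β := β) (f := fun k => dirDeriv (e k))
    (g := fun k (u : ι → E → ℝ) i => dirDeriv (e k) (u i))
    (R := fun (f : E → ℝ) (u : ι → E → ℝ) => SmoothSummable u ∧ f = fun z => ∑' i, u i z)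
    (fun k _ f u hfu => ⟨hfu.1.map_dirDeriv (e k), by rw [hfu.2, hfu.1.map_dirDeriv_tsum]⟩) l ⟨hu, rfl⟩
  have h2 : ∀ i, l.foldr (fun k v => (fun (u : ι → E → ℝ) i => dirDeriv (e k) (u i))^[β k] v) u i =
      iteratedDirDeriv e β l (u i) := fun i =>
    List.foldr_iterate_rel (β := β) (f := fun k (u : ι → E → ℝ) i => dirDeriv (e k) (u i))
      (g := fun k => dirDeriv (e k)) (R := fun (u : ι → E → ℝ) (f : E → ℝ) => u i = f)
      (fun k _ u f huf => by rw [← huf]) l rfl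
  have h3 := h.2
  simp only [h2] at h3
  exact h3

/-- Differentiating in the direction of one of the variables `q j` a function that is polynomial
in these variables. -/
theorem dirDeriv_mul_prod_eval {r : ℕ} (p : E →L[ℝ] X) (q : E →L[ℝ] (Fin r → ℝ)) {s : Set X}
    (hs : IsOpen s) {a : X → ℝ} (ha : ∀ x ∈ s, DifferentiableAt ℝ a x) {j : Fin r} {e : E}
    (hpe : p e = 0) (hqe : q e = Pi.single j 1) {f : E → ℝ} {P : Fin r → Polynomial ℝ}
    (hf : ∀ y, p y ∈ s → f y = a (p y) * ∏ i, (P i).eval (q y i)) {y : E} (hy : p y ∈ s) :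
    dirDeriv e f y = a (p y) *
      ∏ i, (Function.update P j (Polynomial.derivative (P j)) i).eval (q y i) := by
  have hev : f =ᶠ[𝓝 y] fun y => a (p y) * ∏ i, (P i).eval (q y i) :=
    (p.continuous.continuousAt.eventually (hs.mem_nhds hy)).mono hf
  have hd : DifferentiableAt ℝ f y := by
    refine DifferentiableAt.congr_of_eventuallyEq ?_ hev
    refine ((ha _ hy).comp y p.differentiableAt).mul ?_
    refine ContDiffAt.differentiableAt (n := 1) ?_ one_ne_zero
    refine ContDiff.contDiffAt (contDiff_prod fun i _ => ?_)
    have hP : ContDiff ℝ 1 fun t => (P i).eval t := by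
      simpa using (P i).contDiff_aeval (𝕜 := ℝ) 1
    exact hP.comp
      ((ContinuousLinearMap.proj (R := ℝ) (φ := fun _ : Fin r => ℝ) i).comp q).contDiff
  rw [dirDeriv, ← hd.lineDeriv_eq_fderiv]
  refine HasLineDerivAt.lineDeriv ?_
  -- Along this line the base point and the other variables are fixed, leaving a constant times a
  -- polynomial in `t`. Thus `a` is never differentiated.
  have hline : (fun t : ℝ => f (y + t • e)) = fun t : ℝ =>
      (a (p y) * ∏ i ∈ Finset.univ.erase j, (P i).eval (q y i)) * (P j).eval (q y j + t) := by
    ext t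
    have h1 : p (y + t • e) = p y := by rw [map_add, map_smul, hpe, smul_zero, add_zero]
    rw [hf _ (by rwa [h1]), h1, ← Finset.prod_erase_mul _ _ (Finset.mem_univ j), ← mul_assoc]
    congr 2
    · refine Finset.prod_congr rfl fun i hi => ?_
      simp [hqe, Finset.ne_of_mem_erase hi]
    · simp [hqe]
  rw [HasLineDerivAt, hline, ← Finset.prod_erase_mul _ _ (Finset.mem_univ j), ← mul_assoc,
    Function.update_self]
  have h2 : ∏ i ∈ Finset.univ.erase j,
      (Function.update P j (Polynomial.derivative (P j)) i).eval (q y i) =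
      ∏ i ∈ Finset.univ.erase j, (P i).eval (q y i) :=
    Finset.prod_congr rfl fun i hi => by
      rw [Function.update_of_ne (Finset.ne_of_mem_erase hi)]
  rw [h2]
  refine HasDerivAt.const_mul _ ?_
  have h3 := (P j).hasDerivAt (q y j + 0)
  simpa using h3.comp_const_add (q y j) 0

theorem Polynomial.eval_zero_iterate_derivative_X_pow (n k : ℕ) :
    ((Polynomial.derivative^[k]) ((Polynomial.X : Polynomial ℝ) ^ n)).eval 0 =
      if n = k then (k.factorial : ℝ) else 0 := by
  rw [← Polynomial.coeff_zero_eq_eval_zero, Polynomial.coeff_iterate_derivative,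
    Polynomial.coeff_X_pow, zero_add, Nat.descFactorial_self]
  by_cases h : k = n
  · simp [h]
  · simp [h, Ne.symm h]

end IteratedDirDeriv

/-! ### Taylor coefficients along the zero section of $U_0\times\mathbb R^r$ -/

namespace GradedDomain

variable (U : GradedDomain)

/-- Partial derivatives on the base as directional derivatives of any extension. -/
theorem dirDeriv_eq_pderiv (i : Fin U.dim) {f : EuclideanSpace ℝ (Fin U.dim) → ℝ} {g : U.Smooth}
    (h : ∀ y : U.base, f y = g y) (y : U.base) :
    dirDeriv (EuclideanSpace.single i 1) f y = U.pderiv i g y := by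
  have h1 : f =ᶠ[nhds (y : EuclideanSpace ℝ (Fin U.dim))] U.extend g := by
    filter_upwards [U.base.isOpen.mem_nhds y.2] with z hz
    rw [h ⟨z, hz⟩, U.extend_apply g ⟨z, hz⟩]
  rw [dirDeriv, h1.fderiv_eq]
  rfl

theorem iteratedDirDeriv_eq_iteratedPDeriv (α : Fin U.dim →₀ ℕ)
    {f : EuclideanSpace ℝ (Fin U.dim) → ℝ} {g : U.Smooth} (h : ∀ y : U.base, f y = g y)
    (y : U.base) :
    iteratedDirDeriv (fun i => EuclideanSpace.single i 1) α (List.finRange U.dim) f y =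
      U.iteratedPDeriv α g y :=
  List.foldr_iterate_rel
    (R := fun (f : EuclideanSpace ℝ (Fin U.dim) → ℝ) (g : U.Smooth) => ∀ y : U.base, f y = g y)
    (fun i _ _ _ hfg => U.dirDeriv_eq_pderiv i hfg) _ h y

/-- The projection `ℝ ^ (n + r) → ℝ ^ n`. -/
def baseProj (n r : ℕ) : EuclideanSpace ℝ (Fin (n + r)) →L[ℝ] EuclideanSpace ℝ (Fin n) :=
  (EuclideanSpace.equiv (Fin n) ℝ).symm.toContinuousLinearMap.comp
    (ContinuousLinearMap.pi fun i => EuclideanSpace.proj (Fin.castAdd r i))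

/-- The projection `ℝ ^ (n + r) → ℝ ^ r`. -/
def fiberProj (n r : ℕ) : EuclideanSpace ℝ (Fin (n + r)) →L[ℝ] (Fin r → ℝ) :=
  ContinuousLinearMap.pi fun j => EuclideanSpace.proj (Fin.natAdd n j)

theorem baseProj_apply {n r : ℕ} (z : EuclideanSpace ℝ (Fin (n + r))) (i : Fin n) :
    baseProj n r z i = z (Fin.castAdd r i) := rfl

theorem fiberProj_apply {n r : ℕ} (z : EuclideanSpace ℝ (Fin (n + r))) (j : Fin r) :
    fiberProj n r z j = z (Fin.natAdd n j) := rfl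

/-- The product of `U` with `ℝ ^ r` in degree zero. -/
abbrev addBase (r : ℕ) : GradedDomain where
  dim := U.dim + r
  base := ⟨baseProj U.dim r ⁻¹' U.base, U.base.isOpen.preimage (baseProj U.dim r).continuous⟩
  numEven := U.numEven
  numOdd := U.numOdd
  evenDeg := U.evenDeg
  oddDeg := U.oddDeg
  even_evenDeg := U.even_evenDeg
  evenDeg_ne_zero := U.evenDeg_ne_zero
  odd_oddDeg := U.odd_oddDeg

/-- Since `β` involves fibre directions only, this is $\partial_y^\beta y^\alpha$ at $y=0$, which is
$\beta!$ if $\alpha=\beta$ and $0$ otherwise. -/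
theorem iteratedDirDeriv_monomial {n r : ℕ} {s : Set (EuclideanSpace ℝ (Fin n))} (hs : IsOpen s)
    {a : EuclideanSpace ℝ (Fin n) → ℝ} (ha : ∀ x ∈ s, DifferentiableAt ℝ a x)
    {β : Fin (n + r) → ℕ} (hβ : ∀ i, β (Fin.castAdd r i) = 0) (α : Fin r → ℕ)
    {z : EuclideanSpace ℝ (Fin (n + r))} (hz : baseProj n r z ∈ s) (hz0 : fiberProj n r z = 0) :
    iteratedDirDeriv (fun i => EuclideanSpace.single i 1) β (List.finRange (n + r))
        (fun y => a (baseProj n r y) * ∏ j, fiberProj n r y j ^ α j) z =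
      if α = fun j => β (Fin.natAdd n j) then
        (∏ i, ((β i).factorial : ℝ)) * a (baseProj n r z) else 0 := by
  classical
  -- Models the partial derivatives on tuples of one-variable factors; base directions act as the
  -- identity, harmless because `β` vanishes there.
  let D : Fin (n + r) → (Fin r → Polynomial ℝ) → Fin r → Polynomial ℝ := fun k P j =>
    (if k = Fin.natAdd n j then Polynomial.derivative else id : Polynomial ℝ → Polynomial ℝ) (P j)
  have h1 := List.foldr_iterate_rel (β := β)
    (f := fun i => dirDeriv (EuclideanSpace.single i (1 : ℝ))) (g := D)
    (R := fun (f : EuclideanSpace ℝ (Fin (n + r)) → ℝ) (P : Fin r → Polynomial ℝ) =>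
      ∀ y, baseProj n r y ∈ s →
        f y = a (baseProj n r y) * ∏ i, (P i).eval (fiberProj n r y i)) (by
      intro i hi f P hfP y hy
      induction i using Fin.addCases with
      | left i => exact absurd (hβ i) hi
      | right j =>
        rw [dirDeriv_mul_prod_eval (baseProj n r) (fiberProj n r) hs ha (j := j) (P := P) ?_ ?_
          hfP hy]
        · congr 1
          refine Finset.prod_congr rfl fun i _ => ?_
          by_cases hij : i = j
          · subst hij; simp [D]
          · have : Fin.natAdd n j ≠ Fin.natAdd n i := fun h => hij (Fin.natAdd_injective _ _ h).symm
            simp [D, hij, this]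
        · ext i
          rw [baseProj_apply]
          simp [Fin.ext_iff]
          omega
        · ext i
          rw [fiberProj_apply]
          simp [Pi.single_apply])
    (List.finRange (n + r)) (a := fun y => a (baseProj n r y) * ∏ j, fiberProj n r y j ^ α j)
    (b := fun j => Polynomial.X ^ α j) (by intro y _; simp)
  have h2 : ∀ j, (List.finRange (n + r)).foldr (fun i u => (D i)^[β i] u)
      (fun j => Polynomial.X ^ α j) j =
      Polynomial.derivative^[β (Fin.natAdd n j)] (Polynomial.X ^ α j) := by
    intro j
    have h3 := List.foldr_iterate_rel (β := β) (f := D)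
      (g := fun k => (if k = Fin.natAdd n j then Polynomial.derivative else id :
        Polynomial ℝ → Polynomial ℝ)) (R := fun P Q => P j = Q)
      (fun k _ P Q h => by rw [← h]) (List.finRange (n + r))
      (a := fun j => (Polynomial.X : Polynomial ℝ) ^ α j) rfl
    rw [h3, List.foldr_iterate_ite _ _ _ (List.nodup_finRange _), if_pos (List.mem_finRange _)]
  rw [iteratedDirDeriv, h1 z hz]
  simp only [h2, hz0, Pi.zero_apply, Polynomial.eval_zero_iterate_derivative_X_pow]
  split_ifs with h
  · rw [Fin.prod_univ_add, h, mul_comm]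
    simp [hβ]
  · obtain ⟨j, hj⟩ := Function.ne_iff.1 h
    rw [Finset.prod_eq_zero (Finset.mem_univ j) (if_neg hj), mul_zero]

/-- Every family of smooth functions on the base is the family of Taylor coefficients along the
zero section of a smooth function on the product with `ℝ ^ r`. -/
theorem exists_iteratedPDeriv_eq (r : ℕ) (g : (Fin r → ℕ) → U.Smooth) :
    ∃ G : (U.addBase r).Smooth, ∀ β : Fin (U.dim + r) →₀ ℕ, (∀ i, β (Fin.castAdd r i) = 0) →
      ∀ z : (U.addBase r).base, fiberProj U.dim r z.1 = 0 →
        (U.addBase r).iteratedPDeriv β G z = (∏ i, ((β i).factorial : ℝ)) *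
          U.extend (g fun j => β (Fin.natAdd U.dim j)) (baseProj U.dim r z.1) := by
  obtain ⟨G, hG⟩ := exists_eventuallyEq_tsum_of_homogeneous (s := (U.base : Set _)) U.base.isOpen
    (g := fun α => U.extend (g α)) (fun α x hx => U.contDiffAt_extend (g α) ⟨x, hx⟩)
    (baseProj U.dim r) (fiberProj U.dim r) (m := fun α t => ∏ j, t j ^ α j)
    (fun α => contDiff_prod fun j _ => (contDiff_apply ℝ ℝ j).pow _) (N := fun α => ∑ j, α j)
    (fun α c t => by simp [mul_pow, Finset.prod_mul_distrib, Finset.prod_pow_eq_pow_sum])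
    -- Multi-indices of total degree at most $k$ lie in the box $[0,k]^r$.
    (fun k => (Set.finite_Iic (fun _ : Fin r => k)).subset fun α hα j =>
      (Finset.single_le_sum (fun _ _ => Nat.zero_le _) (Finset.mem_univ j)).trans hα)
  have hsm : ∀ z : (U.addBase r).base, ContDiffAt ℝ ∞ G z.1 := by
    intro z
    obtain ⟨u, hu, hGu, -⟩ := hG z.1 z.2
    exact hu.contDiff_tsum.contDiffAt.congr_of_eventuallyEq hGu
  refine ⟨⟨fun z => G z.1, fun z => ?_⟩, fun β hβ z hz => ?_⟩
  · exact contMDiffAt_subtype_iff.2 (contMDiffAt_iff_contDiffAt.2 (hsm z))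
  · refine ((U.addBase r).iteratedDirDeriv_eq_iteratedPDeriv (f := G) β (fun _ => rfl) z
      ).symm.trans ?_
    obtain ⟨u, hu, hGu, hu0⟩ := hG z.1 z.2
    refine (iteratedDirDeriv_congr _ _ _ hGu).eq_of_nhds.trans ?_
    rw [hu.iteratedDirDeriv_tsum]
    have h1 : ∀ α, iteratedDirDeriv (fun i => EuclideanSpace.single i 1) β
        (List.finRange (U.dim + r)) (u α) z.1 =
        if α = fun j => β (Fin.natAdd U.dim j) then
          (∏ i, ((β i).factorial : ℝ)) * U.extend (g α) (baseProj U.dim r z.1) else 0 := fun α =>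
      (iteratedDirDeriv_congr _ _ _ (hu0 hz α)).eq_of_nhds.trans
        (iteratedDirDeriv_monomial U.base.isOpen (fun x hx =>
          (U.contDiffAt_extend (g α) ⟨x, hx⟩).differentiableAt (by simp)) hβ α z.2 hz)
    exact (tsum_congr h1).trans (tsum_ite_eq _ _)

end GradedDomain

namespace MvPowerSeries

variable {σ R : Type*} [Semiring R]

theorem prod_ofFn_monomial_one {n : ℕ} (v : Fin n → σ →₀ ℕ) :
    (List.ofFn fun i => monomial (v i) (1 : R)).prod = monomial (∑ i, v i) 1 := by
  induction n with
  | zero => simp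
  | succ n ih =>
    rw [List.ofFn_succ, List.prod_cons, ih, monomial_mul_monomial, Fin.sum_univ_succ, one_mul]

theorem monomial_one_pow (v : σ →₀ ℕ) (n : ℕ) :
    monomial v (1 : R) ^ n = monomial (n • v) 1 := by
  induction n with
  | zero => simp
  | succ n ih => rw [pow_succ, ih, monomial_mul_monomial, succ_nsmul, one_mul]

end MvPowerSeries

/-! ### The morphism $y_j\mapsto\zeta^{w_j}$ and its pullback terms -/

namespace GradedDomain

variable (U : GradedDomain)

theorem monomial_mem_polynomials (I : Fin U.numEven →₀ ℕ) (a : U.OddAlgebra) :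
    (MvPowerSeries.monomial I a : U.Series) ∈ U.polynomials := by
  classical
  refine (({I} : Finset _) ×ˢ (Finset.univ : Finset (Finset (Fin U.numOdd)))).finite_toSet.subset ?_
  rintro ⟨I', J⟩ h
  simp only [Finset.coe_product, Set.mem_prod, Finset.coe_singleton, Set.mem_singleton_iff,
    Finset.coe_univ, Set.mem_univ, and_true]
  by_contra hn
  refine h ?_
  rw [coef_apply, MvPowerSeries.coeff_monomial, if_neg hn, map_zero]

theorem monomial_mem_homogeneous {I : Fin U.numEven →₀ ℕ} {a : U.OddAlgebra} {k : ℤ}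
    (h : U.oddScale a = U.twoPow (k - U.evenMonomialDeg I) • a) :
    (MvPowerSeries.monomial I a : U.Series) ∈ U.homogeneous k := by
  classical
  rw [mem_homogeneous_iff_oddScale]
  intro I'
  rw [MvPowerSeries.coeff_monomial]
  split_ifs with hI
  · rw [hI, h]
  · simp

theorem ofSmooth_eq_monomial (g : U.Smooth) :
    U.ofSmooth g = MvPowerSeries.monomial 0 (g • (1 : U.OddAlgebra)) := by
  rw [ofSmooth, MvPowerSeries.algebraMap_apply, Algebra.algebraMap_eq_smul_one]
  rfl

theorem body_ofSmooth (g : U.Smooth) : U.body (U.ofSmooth g) = g := by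
  classical
  rw [body, coef_apply, ofSmooth_eq_monomial, MvPowerSeries.coeff_monomial_same, map_smul,
    ← oddBasis_empty]
  simp

theorem body_monomial {I : Fin U.numEven →₀ ℕ} (hI : I ≠ 0) (a : U.OddAlgebra) :
    U.body (MvPowerSeries.monomial I a) = 0 := by
  classical
  rw [body, coef_apply, MvPowerSeries.coeff_monomial, if_neg hI.symm, map_zero]

/-- The coordinate function `xᵢ`. -/
def coordinate (i : Fin U.dim) : U.Smooth :=
  ⟨fun y => (y : EuclideanSpace ℝ (Fin U.dim)) i, fun _ =>
    contMDiffAt_subtype_iff.2 (contMDiffAt_iff_contDiffAt.2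
      (EuclideanSpace.proj (𝕜 := ℝ) i).contDiff.contDiffAt)⟩

section AddBase

variable {r : ℕ} (w : Fin r → Fin U.numEven →₀ ℕ)

/-- The pullbacks of the base coordinates under the morphism to the product with `ℝ ^ r` given by
the monomials `ζ ^ w j`. -/
def addBaseX (i : Fin (U.dim + r)) : U.Series :=
  Fin.addCases (fun i => U.ofSmooth (U.coordinate i)) (fun j => MvPowerSeries.monomial (w j) 1) i

theorem addBaseX_left (i : Fin U.dim) :
    U.addBaseX w (Fin.castAdd r i) = U.ofSmooth (U.coordinate i) := by simp [addBaseX]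

theorem addBaseX_right (j : Fin r) :
    U.addBaseX w (Fin.natAdd U.dim j) = MvPowerSeries.monomial (w j) 1 := by simp [addBaseX]

theorem baseProj_body_addBaseX (y : U.base) :
    baseProj U.dim r (WithLp.toLp 2 fun i => U.body (U.addBaseX w i) y) = y := by
  ext i
  rw [baseProj_apply]
  change U.body (U.addBaseX w (Fin.castAdd r i)) y = _
  rw [addBaseX_left, body_ofSmooth]
  rfl

/-- The base map lands in the zero section, the only place where the Taylor coefficients are
prescribed. -/
theorem fiberProj_body_addBaseX (hw : ∀ j, w j ≠ 0) (y : U.base) :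
    fiberProj U.dim r (WithLp.toLp 2 fun i => U.body (U.addBaseX w i) y) = 0 := by
  ext j
  rw [fiberProj_apply]
  change U.body (U.addBaseX w (Fin.natAdd U.dim j)) y = _
  rw [addBaseX_right, body_monomial _ (hw j)]
  rfl

/-- The morphism to the product with `ℝ ^ r` given by nonconstant monomials of degree zero. -/
def addBaseMorphism (hd : ∀ j, U.evenMonomialDeg (w j) = 0) : Morphism U (U.addBase r) where
  x := U.addBaseX w
  ζ := fun a => MvPowerSeries.monomial (Finsupp.single a 1) 1
  η := fun b => MvPowerSeries.monomial 0 (U.theta b)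
  x_mem := by
    intro i
    induction i using Fin.addCases with
    | left i =>
      rw [addBaseX_left]
      exact U.ofSmooth_mem_homogeneous _
    | right j =>
      rw [addBaseX_right]
      exact U.monomial_mem_homogeneous (by simp [hd, twoPow_zero])
  ζ_mem := fun a => U.monomial_mem_homogeneous (by
    have h : U.evenMonomialDeg (Finsupp.single a 1) = U.evenDeg a := by
      change ∑ a', ((Finsupp.single a 1 a' : ℕ) : ℤ) * U.evenDeg a' = _
      simp [Finsupp.single_apply]
    simp [h, twoPow_zero])
  η_mem := fun b => U.monomial_mem_homogeneous (by simp [oddScale_theta])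
  body_mem := fun y => by
    change baseProj U.dim r _ ∈ U.base
    rw [baseProj_body_addBaseX]
    exact y.2

variable (hd : ∀ j, U.evenMonomialDeg (w j) = 0)

theorem addBaseMorphism_isOfType {C : ∀ U : GradedDomain, Set U.Series}
    (hC : ∀ U : GradedDomain, U.polynomials ⊆ C U) : (U.addBaseMorphism w hd).IsOfType C := by
  refine ⟨fun i => hC U ?_, fun a => hC U (U.monomial_mem_polynomials _ _),
    fun b => hC U (U.monomial_mem_polynomials _ _)⟩
  change U.addBaseX w i ∈ U.polynomials
  induction i using Fin.addCases with
  | left i =>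
    rw [addBaseX_left, ofSmooth_eq_monomial]
    exact U.monomial_mem_polynomials _ _
  | right j =>
    rw [addBaseX_right]
    exact U.monomial_mem_polynomials _ _

theorem prod_ofFn_addBaseX (hw : ∀ j, w j ≠ 0) {α : Fin (U.dim + r) →₀ ℕ}
    (hα : ∀ i, α (Fin.castAdd r i) = 0) :
    (List.ofFn fun i => (U.addBaseX w i - U.ofSmooth (U.body (U.addBaseX w i))) ^ α i).prod =
      MvPowerSeries.monomial (∑ j, α (Fin.natAdd U.dim j) • w j) 1 := by
  have h : ∀ i, (U.addBaseX w i - U.ofSmooth (U.body (U.addBaseX w i))) ^ α i =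
      MvPowerSeries.monomial (α i • Fin.addCases (fun _ => 0) w i) 1 := by
    intro i
    induction i using Fin.addCases with
    | left i => simp [hα]
    | right j =>
      rw [addBaseX_right, body_monomial _ (hw j), ofSmooth, map_zero, sub_zero,
        MvPowerSeries.monomial_one_pow, Fin.addCases_right]
  simp_rw [h]
  rw [MvPowerSeries.prod_ofFn_monomial_one, Fin.sum_univ_add]
  simp

/-- The old base coordinates pull back to themselves, so $\varphi^*x_i-x_0$ vanishes and only fibre
derivatives enter the pullback. -/
theorem prod_ofFn_addBaseX_eq_zero {α : Fin (U.dim + r) →₀ ℕ} {i : Fin U.dim}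
    (hα : α (Fin.castAdd r i) ≠ 0) :
    (List.ofFn fun i => (U.addBaseX w i - U.ofSmooth (U.body (U.addBaseX w i))) ^ α i).prod =
      0 := by
  refine List.prod_eq_zero (List.mem_ofFn.2 ⟨Fin.castAdd r i, ?_⟩)
  rw [addBaseX_left, body_ofSmooth, sub_self, zero_pow hα]

theorem prod_ofFn_monomial_theta (J : Finset (Fin U.numOdd)) :
    (List.ofFn fun b => if b ∈ J then (MvPowerSeries.monomial 0 (U.theta b) : U.Series)
      else 1).prod = MvPowerSeries.monomial 0 (U.oddBasis J) := by
  have h : (fun b => if b ∈ J then (MvPowerSeries.monomial 0 (U.theta b) : U.Series) else 1) =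
      (MvPowerSeries.C (σ := Fin U.numEven)) ∘ fun b => if b ∈ J then U.theta b else 1 := by
    ext1 b
    by_cases hb : b ∈ J <;> simp [hb, MvPowerSeries.monomial_zero_eq_C_apply]
  rw [h, ← List.map_ofFn, ← map_list_prod, ← oddBasis_eq_prod]
  rfl

/-- The factorial in `hg` cancels the $1/\alpha!$ of the Taylor expansion, so each term is a single
power of $\zeta$ with the prescribed coefficient. -/
theorem pullbackTerm_addBaseMorphism (hw : ∀ j, w j ≠ 0) {f : (U.addBase r).Series}
    {α : Fin (U.dim + r) →₀ ℕ} (hα : ∀ i, α (Fin.castAdd r i) = 0) {I : Fin U.numEven →₀ ℕ}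
    {J : Finset (Fin U.numOdd)} {g : U.Smooth}
    (hg : ∀ z : (U.addBase r).base, fiberProj U.dim r z.1 = 0 →
      (U.addBase r).iteratedPDeriv α ((U.addBase r).coef I J f) z =
        (∏ i, ((α i).factorial : ℝ)) * U.extend g (baseProj U.dim r z.1)) :
    (U.addBaseMorphism w hd).pullbackTerm f α I J =
      MvPowerSeries.monomial (I + ∑ j, α (Fin.natAdd U.dim j) • w j) (g • U.oddBasis J) := by
  have h1 : (∏ i, ((α i).factorial : ℝ))⁻¹ • (U.addBaseMorphism w hd).baseComp
      ((U.addBase r).iteratedPDeriv α ((U.addBase r).coef I J f)) = g := by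
    ext y
    have h2 := hg ((U.addBaseMorphism w hd).baseMap y) (U.fiberProj_body_addBaseX w hw y)
    have h3 : baseProj U.dim r ((U.addBaseMorphism w hd).baseMap y).1 = y :=
      U.baseProj_body_addBaseX w y
    rw [h3, extend_apply] at h2
    change (∏ i, ((α i).factorial : ℝ))⁻¹ * (U.addBase r).iteratedPDeriv α
      ((U.addBase r).coef I J f) ((U.addBaseMorphism w hd).baseMap y) = g y
    rw [h2, inv_mul_cancel_left₀]
    exact Finset.prod_ne_zero_iff.2 fun i _ => by positivity
  have h4 := U.prod_ofFn_addBaseX w hw hα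
  have h5 : (List.ofFn fun a => (MvPowerSeries.monomial (Finsupp.single a 1) 1 : U.Series) ^
      I a).prod = MvPowerSeries.monomial I 1 := by
    simp_rw [MvPowerSeries.monomial_one_pow]
    rw [MvPowerSeries.prod_ofFn_monomial_one]
    simp [Finsupp.univ_sum_single]
  have h6 := U.prod_ofFn_monomial_theta J
  rw [Morphism.pullbackTerm, h1]
  change U.ofSmooth g * (List.ofFn fun i => (U.addBaseX w i - U.ofSmooth
    (U.body (U.addBaseX w i))) ^ α i).prod * (List.ofFn fun a =>
      (MvPowerSeries.monomial (Finsupp.single a 1) 1 : U.Series) ^ I a).prod *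
    (List.ofFn fun b => if b ∈ J then (MvPowerSeries.monomial 0 (U.theta b) : U.Series)
      else 1).prod = _
  rw [h4, h5, h6, ofSmooth_eq_monomial, MvPowerSeries.monomial_mul_monomial,
    MvPowerSeries.monomial_mul_monomial, MvPowerSeries.monomial_mul_monomial]
  congr 1
  · rw [zero_add, add_zero, add_comm]
  · simp

theorem pullbackTerm_addBaseMorphism_eq_zero {f : (U.addBase r).Series}
    {α : Fin (U.dim + r) →₀ ℕ} {i : Fin U.dim} (hα : α (Fin.castAdd r i) ≠ 0)
    (I : Fin U.numEven →₀ ℕ) (J : Finset (Fin U.numOdd)) :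
    (U.addBaseMorphism w hd).pullbackTerm f α I J = 0 := by
  have h := U.prod_ofFn_addBaseX_eq_zero w hα
  rw [Morphism.pullbackTerm]
  change _ * (List.ofFn fun i => (U.addBaseX w i - U.ofSmooth
    (U.body (U.addBaseX w i))) ^ α i).prod * _ * _ = _
  rw [h, mul_zero, zero_mul, zero_mul]

end AddBase

/-! ### Graded functions as pullbacks of polynomials -/

/-- Every graded function is the pullback of a polynomial along a morphism with polynomial
components. -/
theorem exists_pullback_eq {f : U.Series} (hf : f ∈ U.gradedFunctions) :
    ∃ (r : ℕ) (w : Fin r → Fin U.numEven →₀ ℕ) (hd : ∀ j, U.evenMonomialDeg (w j) = 0),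
      ∃ f' ∈ (U.addBase r).polynomials, (U.addBaseMorphism w hd).pullback f' = f := by
  classical
  obtain ⟨K, hK⟩ := U.mem_gradedFunctions.1 hf
  let K' : Finset ℤ := (K ×ˢ (Finset.univ : Finset (Finset (Fin U.numOdd)))).image
    fun kJ => kJ.1 - ∑ b ∈ kJ.2, U.oddDeg b
  have hK' : ∀ I J, U.coef I J f ≠ 0 → U.evenMonomialDeg I ∈ K' := fun I J h =>
    Finset.mem_image.2 ⟨(U.monomialDeg I J, J), by simp [hK I J h], by simp [monomialDeg_eq]⟩
  obtain ⟨r, w, M, hw, hd, hM⟩ := Finsupp.exists_generators_of_map_mem U.evenMonomialDeg K'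
  choose! m hmM a hma using hM
  -- An exponent may decompose as $m+\sum\alpha_jw_j$ in several ways; the condition keeps only the
  -- chosen one, so each coefficient of `f` is counted once.
  let g : (Fin U.numEven →₀ ℕ) → Finset (Fin U.numOdd) → (Fin r → ℕ) → U.Smooth := fun I J α =>
    if m (I + ∑ j, α j • w j) = I ∧ a (I + ∑ j, α j • w j) = α then
      U.coef (I + ∑ j, α j • w j) J f else 0
  choose G hG using fun I J => U.exists_iteratedPDeriv_eq r (g I J)
  let f' : (U.addBase r).Series := (U.addBase r).ofCoef fun I J => if I ∈ M then G I J else 0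
  refine ⟨r, w, hd, f', ?_, ?_⟩
  · refine (M ×ˢ (Finset.univ : Finset (Finset (Fin U.numOdd)))).finite_toSet.subset ?_
    rintro ⟨I, J⟩ h
    have h1 : (U.addBase r).coef I J f' ≠ 0 := h
    rw [coef_ofCoef] at h1
    simpa using fun hI => h1 (if_neg hI)
  · ext1 L
    let αL : Fin (U.dim + r) →₀ ℕ :=
      Finsupp.equivFunOnFinite.symm (Fin.addCases (fun _ => 0) (a L))
    have hterm : ∀ (α : Fin (U.dim + r) →₀ ℕ) I J, MvPowerSeries.coeff L
        ((U.addBaseMorphism w hd).pullbackTerm f' α I J) =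
        if α = αL ∧ I = m L then U.coef L J f • U.oddBasis J else 0 := by
      intro α I J
      by_cases hα : ∀ i, α (Fin.castAdd r i) = 0
      swap
      · obtain ⟨i, hi⟩ := not_forall.1 hα
        rw [pullbackTerm_addBaseMorphism_eq_zero _ _ _ hi, map_zero, if_neg]
        rintro ⟨rfl, -⟩
        exact hi (by simp [αL])
      have hαL : α = αL ↔ (fun j => α (Fin.natAdd U.dim j)) = a L := by
        constructor
        · rintro rfl
          ext j
          simp [αL]
        · intro h
          ext i
          induction i using Fin.addCases with
          | left i => simp [hα, αL]
          | right j => simpa [αL] using congrFun h j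
      by_cases hI : I ∈ M
      · rw [U.pullbackTerm_addBaseMorphism w hd hw hα
          (g := g I J fun j => α (Fin.natAdd U.dim j)) (by
            rw [coef_ofCoef, if_pos hI]
            exact hG I J α hα), MvPowerSeries.coeff_monomial]
        by_cases hL : L = I + ∑ j, α (Fin.natAdd U.dim j) • w j
        · rw [if_pos hL]
          simp only [g]
          rw [← hL, ite_smul, zero_smul]
          refine if_congr ?_ rfl rfl
          rw [hαL, and_comm, eq_comm (a := I), eq_comm (a := a L)]
        · rw [if_neg hL]
          split_ifs with h
          -- The chosen `m L` and `a L` need not recompose to `L` when its degree is outside `K'`,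
          -- but then the coefficients of `f` at `L` vanish.
          · have h0 : U.coef L J f = 0 := by
              by_contra hne
              refine hL ?_
              rw [h.2]
              have h2 := hma L (hK' L J hne)
              rw [← hαL.1 h.1] at h2
              exact h2
            rw [h0, zero_smul]
          · rfl
      · rw [Morphism.pullbackTerm_of_coef_eq_zero, map_zero]
        · split_ifs with h
          · have h0 : U.coef L J f = 0 := by
              by_contra hne
              exact hI (h.2 ▸ hmM L (hK' L J hne))
            rw [h0, zero_smul]
          · rfl
        · rw [coef_ofCoef, if_neg hI, iteratedPDeriv_zero, Morphism.baseComp_zero]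
    change (∑ᶠ x : (Fin (U.dim + r) →₀ ℕ) × (Fin U.numEven →₀ ℕ) × Finset (Fin U.numOdd),
      MvPowerSeries.coeff L ((U.addBaseMorphism w hd).pullbackTerm f' x.1 x.2.1 x.2.2)) = _
    simp_rw [hterm]
    -- Only $(\alpha_L,m(L))$ contributes at `L`; the remaining sum over `J` is the basis expansion
    -- of that coefficient.
    rw [finsum_eq_sum_of_support_subset (s := Finset.univ.image fun J => (αL, m L, J)),
      Finset.sum_image fun J _ J' _ h => congrArg (fun x => x.2.2) h]
    · simp only [and_self, if_true]
      exact U.oddBasis.sum_repr _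
    · rintro ⟨α, I, J⟩ h
      rw [Function.mem_support, ne_eq, ite_eq_right_iff, Classical.not_imp] at h
      exact Finset.mem_coe.2 (Finset.mem_image.2
        ⟨J, Finset.mem_univ J, Prod.ext h.1.1.symm (Prod.ext h.1.2.symm rfl)⟩)

end GradedDomain

end

theorem mainTheorem3 :
    (∀ U : GradedDomain, ∃ S : Subalgebra ℝ U.Series,
      (S : Set U.Series) = (U.gradedFunctions : Set U.Series)) ∧
    IsLeast {C : ∀ U : GradedDomain, Set U.Series |
        (∀ U, U.polynomials ⊆ C U) ∧ GradedDomain.IsStable C}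
      (fun U => (U.gradedFunctions : Set U.Series)) := by
  refine ⟨fun U => ⟨U.gradedFunctionsSubalgebra, rfl⟩,
    ⟨fun U => U.polynomials_subset_gradedFunctions,
      fun U U' φ _ f hf => φ.pullback_mem_gradedFunctions hf⟩, ?_⟩
  rintro C ⟨hC, hstable⟩ U f hf
  obtain ⟨r, w, hd, f', hf', rfl⟩ := U.exists_pullback_eq hf
  exact hstable U (U.addBase r) _ (U.addBaseMorphism_isOfType w hd hC) f' (hC _ hf')
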